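/- Let $\Lambda$ be an artin algebra, i.e. an algebra that is finitely generated as a module over a commutative artinian ring. Let $\Lambda\text{-Mod}$ be the category of all left $\Lambda$-modules and $\Lambda\text{-mod}$ the abelian category of finitely generated ones. For an integer $n\ge 1$, a full subcategory $\mathcal M$ of an abelian category $\mathcal A$ is called $n$-cluster tilting if * every object of $\mathcal A$ is a quotient of an object of $\mathcal M$ and a subobject of an object of $\mathcal M$; * $\mathcal M$ is functorially finite: for every $A\in\mathcal A$ there are a morphism $X\to A$ with $X\in\mathcal M$ through which every morphism from an object of $\mathcal M$ to $A$ factors, and a morphism $A\to X'$ with $X'\in\mathcal M$ through which every morphism from $A$ to an object of $\mathcal M$ factors; * $\mathcal M=\{Y\in\mathcal A : \operatorname{Ext}^i_{\mathcal A}(X,Y)=0 \text{ for all } X\in\mathcal M,\ 0<i<n\}=\{X\in\mathcal A : \operatorname{Ext}^i_{\mathcal A}(X,Y)=0 \text{ for all } Y\in\mathcal M,\ 0<i<n\}$. Let $n\ge 2$ and let $\mathcal M$ be an $n$-cluster tilting subcategory of $\Lambda\text{-mod}$. Let $\operatorname{Add}(\mathcal M)$ be the full subcategory of $\Lambda\text{-Mod}$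 consisting of the direct summands of arbitrary direct sums of modules in $\mathcal M$. Then the following statements are equivalent. (a) $\mathcal M$ is of finite type, i.e. there is $G\in\mathcal M$ such that $\mathcal M$ consists exactly of the direct summands of finite direct sums of copies of $G$. (b) $\{X\in\Lambda\text{-Mod} : \operatorname{Ext}^i_\Lambda(M,X)=0 \text{ for all } M\in\mathcal M \text{ and } 0<i<n\}=\operatorname{Add}(\mathcal M)$. (c) $\{X\in\Lambda\text{-Mod} : \operatorname{Ext}^i_\Lambda(M,X)=0 \text{ for all } M\in\mathcal M \text{ and } 0<i<n\}\subseteq\operatorname{Add}(\mathcal M)$. (d) $\operatorname{Add}(\mathcal M)$ is an $n$-cluster tilting subcategory of $\Lambda\text{-Mod}$. -/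

import Mathlib

open CategoryTheory CategoryTheory.Limits

universe w v u

/-- `Λ` is an artin algebra: it is a module-finite algebra over a commutative artinian ring.
(The base ring may be replaced by its image in the center of `Λ`, so taking it in the universe
of `Λ` is no restriction.) -/
class IsArtinAlgebra (Λ : Type u) [Ring Λ] : Prop where
  exists_base : ∃ (R : Type u) (_ : CommRing R) (_ : IsArtinianRing R) (_ : Algebra R Λ),
    Module.Finite R Λ

/-- An artin algebra is left noetherian, so that its category of finitely generated left
modules is abelian. -/
instance IsArtinAlgebra.isNoetherianRing (Λ : Type u) [Ring Λ] [h : IsArtinAlgebra Λ] :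
    IsNoetherianRing Λ := by
  obtain ⟨R, _, _, _, _⟩ := h.exists_base
  exact isNoetherian_of_tower R (inferInstance : IsNoetherian R Λ)

/-- Finitely generated modules over a left noetherian ring have enough projectives. -/
instance FGModuleCat.enoughProjectives (Λ : Type u) [Ring Λ] [IsNoetherianRing Λ] :
    EnoughProjectives (FGModuleCat.{u} Λ) where
  presentation X := by
    obtain ⟨m, f, hf⟩ := Module.Finite.exists_fin' Λ X
    have surj_of_epi : ∀ {A B : FGModuleCat.{u} Λ} (g : A ⟶ B), Epi g →
        Function.Surjective g.hom.hom := by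
      intro A B g _
      rw [← LinearMap.range_eq_top, ← Submodule.ker_mkQ (LinearMap.range g.hom.hom),
        LinearMap.ker_eq_top]
      have key : g ≫ FGModuleCat.ofHom (LinearMap.range g.hom.hom).mkQ =
          g ≫ FGModuleCat.ofHom (0 : B →ₗ[Λ] (B ⧸ LinearMap.range g.hom.hom)) := by
        apply FGModuleCat.hom_ext
        ext x
        exact (Submodule.Quotient.mk_eq_zero _).2 ⟨x, rfl⟩
      have h2 := (cancel_epi g).1 key
      exact congrArg (fun t => t.hom.hom) h2
    have hproj : Projective (FGModuleCat.of Λ (Fin m → Λ)) := by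
      refine ⟨fun {E Y} a e he => ?_⟩
      obtain ⟨b, hb⟩ := Module.projective_lifting_property e.hom.hom a.hom.hom (surj_of_epi e he)
      exact ⟨FGModuleCat.ofHom b, FGModuleCat.hom_ext hb⟩
    have hepi : Epi (FGModuleCat.ofHom f) := by
      refine ⟨fun {Z} a b hab => ?_⟩
      apply FGModuleCat.hom_ext
      apply LinearMap.ext
      intro x
      obtain ⟨y, rfl⟩ := hf x
      exact congrArg (fun t => t.hom.hom y) hab
    exact ⟨@ProjectivePresentation.mk _ _ _ _ hproj (FGModuleCat.ofHom f) hepi⟩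

/-- The groups `Ext^i` of the abelian category of finitely generated modules live in the
universe of the ring. -/
instance FGModuleCat.hasExt (Λ : Type u) [Ring Λ] [IsNoetherianRing Λ] :
    HasExt.{u} (FGModuleCat.{u} Λ) :=
  hasExt_of_enoughProjectives.{u} (FGModuleCat.{u} Λ)

namespace ClusterTilting

section Category

variable {C : Type u} [Category.{v} C]

/-- Every object is a quotient of an object of `M`. -/
def IsGenerating (M : ObjectProperty C) : Prop :=
  ∀ A : C, ∃ (X : C) (f : X ⟶ A), M X ∧ Epi f

/-- Every object is a subobject of an object of `M`. -/
def IsCogenerating (M : ObjectProperty C) : Prop :=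
  ∀ A : C, ∃ (X : C) (f : A ⟶ X), M X ∧ Mono f

/-- `θ : X ⟶ A` is a right `M`-approximation of `A`. -/
def IsRightApproximation (M : ObjectProperty C) {X A : C} (θ : X ⟶ A) : Prop :=
  M X ∧ ∀ (Y : C) (f : Y ⟶ A), M Y → ∃ g : Y ⟶ X, g ≫ θ = f

/-- `θ : A ⟶ X` is a left `M`-approximation of `A`. -/
def IsLeftApproximation (M : ObjectProperty C) {A X : C} (θ : A ⟶ X) : Prop :=
  M X ∧ ∀ (Y : C) (f : A ⟶ Y), M Y → ∃ g : X ⟶ Y, θ ≫ g = f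

/-- Every object has a right `M`-approximation. -/
def IsContravariantlyFinite (M : ObjectProperty C) : Prop :=
  ∀ A : C, ∃ (X : C) (θ : X ⟶ A), IsRightApproximation M θ

/-- Every object has a left `M`-approximation. -/
def IsCovariantlyFinite (M : ObjectProperty C) : Prop :=
  ∀ A : C, ∃ (X : C) (θ : A ⟶ X), IsLeftApproximation M θ

end Category

section Abelian

variable {C : Type u} [Category.{v} C] [Abelian C]

/-- The objects `Y` with `Ext^i(X, Y) = 0` for all `X` in `M` and `0 < i < n`. -/
def rightPerp [HasExt.{w} C] (n : ℕ) (M : ObjectProperty C) : ObjectProperty C :=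
  fun Y => ∀ X : C, M X → ∀ i : ℕ, 0 < i → i < n → Subsingleton (Abelian.Ext.{w} X Y i)

/-- The objects `X` with `Ext^i(X, Y) = 0` for all `Y` in `M` and `0 < i < n`. -/
def leftPerp [HasExt.{w} C] (n : ℕ) (M : ObjectProperty C) : ObjectProperty C :=
  fun X => ∀ Y : C, M Y → ∀ i : ℕ, 0 < i → i < n → Subsingleton (Abelian.Ext.{w} X Y i)

/-- `M` is an `n`-cluster tilting subcategory of the abelian category `C`: it is
generating-cogenerating, functorially finite, and equal to both of its `n`-perpendicular
classes. -/
structure IsClusterTilting [HasExt.{w} C] (n : ℕ) (M : ObjectProperty C) : Prop where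
  generating : IsGenerating M
  cogenerating : IsCogenerating M
  contravariantlyFinite : IsContravariantlyFinite M
  covariantlyFinite : IsCovariantlyFinite M
  rightPerp_eq : rightPerp.{w} n M = M
  leftPerp_eq : leftPerp.{w} n M = M

/-- `add(G)`: the direct summands of finite direct sums of copies of `G` (finite coproducts
in an abelian category are direct sums). -/
def addGen (G : C) : ObjectProperty C :=
  fun X => ∃ m : ℕ, Nonempty (Retract X (∐ fun _ : Fin m => G))

/-- `M` is of finite type: it has an additive generator. -/
def IsOfFiniteType (M : ObjectProperty C) : Prop :=
  ∃ G : C, M = addGen G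

end Abelian

section Module

variable {Λ : Type u} [Ring Λ]

/-- A class of finitely generated modules, regarded (up to isomorphism) as a class of objects
of the category of all modules. -/
def toMod (M : ObjectProperty (FGModuleCat.{u} Λ)) : ObjectProperty (ModuleCat.{u} Λ) :=
  M.map (ModuleCat.isFG.{u} Λ).ι

/-- `Add(P)`: the direct summands of arbitrary direct sums of modules in `P`. -/
def AddClosure (P : ObjectProperty (ModuleCat.{u} Λ)) : ObjectProperty (ModuleCat.{u} Λ) :=
  fun X => ∃ (ι : Type u) (Y : ι → ModuleCat.{u} Λ), (∀ i, P (Y i)) ∧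
    Nonempty (Retract X (ModuleCat.of Λ (DirectSum ι fun i => Y i)))

end Module

end ClusterTilting

/-! The perpendicular class in (b) and (c) is the class of modules X such that every map from a
finitely generated module to X factors through a module in `M`
(`IsClusterTilting.rightPerp_iff_locallyFactors`). One direction shifts dimension along cokernels of
left approximations until the cokernel lies in `M`. The other shifts along syzygies. This class is
closed under products, direct sums and quotients by pure submodules, so the equivalence of (a) and
(c) becomes a question about pure submodules and approximations, with no Ext left in it.

For (c) ⇒ (a), suppose there are infinitely many pairwise non-isomorphic T_j in `M` with local
endomorphism ring. Then ∏T_j/⊕T_j is nonzero and locally factors through `M`, so by (c) it has a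
finitely generated summand N with local endomorphism ring. The inclusion of N lifts to ∏T_j, and the
coordinate with T_j ≅ N can be erased without changing the class modulo ⊕T_j. So N splits off ∏T_j
by a map none of whose coordinates splits, which `comp_pi_ne_id` forbids. That lemma holds because
tensoring with the finitely presented dual DN commutes with products, and it is proved through
duality over the artinian base ring.

For (a) ⇒ (c), let G be an additive generator. A nonzero map G → X that is not a sum of maps
factoring through the radical of End G restricts to a pure embedding of some indecomposable summand
of G (`IsApproximating.exists_isPureMap`). By Zorn there is a maximal pure direct sum inside X. Its
quotient again locally factors, so it would contain a further pure summand unless it is zero. Hence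
X is a direct sum of modules in `M`.

For (c) ⇒ (d), right approximations are sums over all maps from small models. Left approximations
are products over all maps to them, which lie in Add(`M`) by (c); there ⊕ → ∏ splits. The remaining
equality of perpendicular classes is a dimension shift. The steps (d) ⇒ (b) ⇒ (c) are formal. -/

namespace ClusterTilting

/-! ### Matlis-type duality over a commutative ring. -/

section DualizingModule

variable {R : Type u} [CommRing R]

/-- `E` is an injective cogenerator over `R` whose socle is multiplicity free. -/
structure IsDualizingModule (R : Type u) [CommRing R] (E : Type u) [AddCommGroup E] [Module R E] :
    Prop where
  injective : Module.Injective R E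
  exists_ne_zero : ∀ (N : Type u) [AddCommGroup N] [Module R N] (x : N), x ≠ 0 →
    ∃ ξ : N →ₗ[R] E, ξ x ≠ 0
  length_hom_le : ∀ (V : Type u) [AddCommGroup V] [Module R V] [IsSimpleModule R V],
    Module.length R (V →ₗ[R] E) ≤ 1

/-- Every submodule of an injective module lies essentially in a retract of that module. -/
theorem exists_essential_retract {I : Type u} [AddCommGroup I] [Module R I]
    (hI : Module.Injective R I) (S : Submodule R I) :
    ∃ (E : Submodule R I) (k : I →ₗ[R] I), S ≤ E ∧
      (∀ x ∈ E, x ≠ 0 → ∃ r : R, r • x ∈ S ∧ r • x ≠ 0) ∧ (∀ x, k x ∈ E) ∧ ∀ x ∈ E, k x = x := by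
  obtain ⟨E, hSE, hE⟩ := zorn_le_nonempty₀
    {E : Submodule R I | ∀ x ∈ E, x ≠ 0 → ∃ r : R, r • x ∈ S ∧ r • x ≠ 0} (by
      intro c hc hchain y hy
      refine ⟨sSup c, fun x hx hx0 => ?_, fun z hz => le_sSup hz⟩
      obtain ⟨z, hz, hxz⟩ := (Submodule.mem_sSup_of_directed ⟨y, hy⟩ hchain.directedOn).1 hx
      exact hc hz x hxz hx0) S (fun x hx hx0 => ⟨1, by simpa using hx, by simpa using hx0⟩)
  obtain ⟨Q, -, hQ⟩ := zorn_le_nonempty₀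
    {Q : Submodule R I | ∀ x ∈ Q, x ∈ E → x = 0} (by
      intro c hc hchain y hy
      refine ⟨sSup c, fun x hx hx0 => ?_, fun z hz => le_sSup hz⟩
      obtain ⟨z, hz, hxz⟩ := (Submodule.mem_sSup_of_directed ⟨y, hy⟩ hchain.directedOn).1 hx
      exact hc hz x hxz hx0) ⊥ (fun x hx _ => by simpa using hx)
  -- `E` meets `Q` trivially, so it embeds in I/`Q`; extending its inclusion over I/`Q` gives a map
  -- that is the identity on `E` and kills `Q`.
  obtain ⟨h, hh⟩ := hI.out (Q.mkQ ∘ₗ E.subtype) (by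
    rw [← LinearMap.ker_eq_bot, LinearMap.ker_eq_bot']
    intro x hx
    have : (x : I) ∈ Q := by simpa using hx
    exact Subtype.ext (hQ.prop _ this x.2)) E.subtype
  have hk : ∀ x ∈ E, (h ∘ₗ Q.mkQ) x = x := fun x hx => hh ⟨x, hx⟩
  have hkQ : ∀ x ∈ Q, (h ∘ₗ Q.mkQ) x = 0 := fun x hx => by
    have : Q.mkQ x = 0 := by simpa using hx
    simp only [LinearMap.comp_apply, this, map_zero]
  refine ⟨E, h ∘ₗ Q.mkQ, hSE, hE.prop, fun x => ?_, hk⟩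
  -- The image is still an essential extension of `S`: for y outside `Q`, maximality of `Q` makes
  -- `Q` + Ry meet `E`, so a multiple of the image of y is a nonzero element of `E`. Maximality of
  -- `E` then makes the image equal to `E`.
  have hle : E ≤ LinearMap.range (h ∘ₗ Q.mkQ) := fun x hx => ⟨x, hk x hx⟩
  refine hE.le_of_ge (y := LinearMap.range (h ∘ₗ Q.mkQ)) ?_ hle ⟨x, rfl⟩
  rintro _ ⟨y, rfl⟩ hy0
  have hy : y ∉ Q := fun hyQ => hy0 (hkQ y hyQ)
  have hnot : ¬ ∀ z ∈ Q ⊔ R ∙ y, z ∈ E → z = 0 := fun hall =>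
    hy (hQ.le_of_ge (y := Q ⊔ R ∙ y) hall le_sup_left
      (Submodule.mem_sup_right (Submodule.mem_span_singleton_self y)))
  push Not at hnot
  obtain ⟨z, hz, hzE, hz0⟩ := hnot
  obtain ⟨q, hq, w, hw, rfl⟩ := Submodule.mem_sup.1 hz
  obtain ⟨r, rfl⟩ := Submodule.mem_span_singleton.1 hw
  have h1 := hk _ hzE
  rw [map_add, hkQ q hq, zero_add, map_smul] at h1
  obtain ⟨s, hs, hs0⟩ := hE.prop _ hzE hz0
  rw [← h1, smul_smul] at hs hs0
  exact ⟨s * r, hs, hs0⟩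

/-- Take a maximal essential extension, inside an injective module, of the product of all residue
fields. The product contains every simple module, which makes the extension a cogenerator.
Essentiality creates no new simple submodules, so a simple module can only map into the factor of
its own maximal ideal. -/
theorem exists_isDualizingModule (R : Type u) [CommRing R] :
    ∃ (E : Type u) (_ : AddCommGroup E) (_ : Module R E), IsDualizingModule R E := by
  let B := ∀ m : MaximalSpectrum R, R ⧸ m.asIdeal
  let ip : InjectivePresentation (ModuleCat.of R B) := Classical.arbitrary _
  let I : Type u := ip.J
  have hI : Module.Injective R I := by
    have : Injective (ModuleCat.of R I) := ip.injective
    exact Module.injective_module_of_injective_object R I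
  let i : B →ₗ[R] I := ip.f.hom
  have hi : Function.Injective i := (ModuleCat.mono_iff_injective ip.f).1 ip.mono
  obtain ⟨E, k, hSE, hess, hkE, hk⟩ := exists_essential_retract hI (LinearMap.range i)
  have hEinj : Module.Injective R E := ⟨fun X Y _ _ _ _ f hf g => by
    obtain ⟨h, hh⟩ := hI.out f hf (E.subtype ∘ₗ g)
    refine ⟨(k ∘ₗ h).codRestrict E fun y => hkE _, fun x => Subtype.ext ?_⟩
    simp [hh, hk]⟩
  refine ⟨E, inferInstance, inferInstance, hEinj, fun N _ _ x hx => ?_, fun V _ _ _ => ?_⟩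
  · let t := LinearMap.toSpanSingleton R N x
    have ht : LinearMap.ker t ≠ ⊤ := by
      intro h
      have : t 1 = 0 := LinearMap.mem_ker.1 (h ▸ Submodule.mem_top)
      exact hx (by simpa [t] using this)
    obtain ⟨m, hm, hle⟩ := Ideal.exists_le_maximal (LinearMap.ker t) ht
    classical
    let m' : MaximalSpectrum R := ⟨m, hm⟩
    let g : (R ⧸ LinearMap.ker t) →ₗ[R] E :=
      (((i ∘ₗ LinearMap.single R (fun m : MaximalSpectrum R => R ⧸ m.asIdeal) m').codRestrict E
        fun y => hSE ⟨_, rfl⟩)) ∘ₗ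
        Submodule.mapQ (LinearMap.ker t) m LinearMap.id hle
    obtain ⟨ξ, hξ⟩ := hEinj.out ((LinearMap.ker t).liftQ t le_rfl)
      (LinearMap.ker_eq_bot.1 (Submodule.ker_liftQ_eq_bot _ _ _ le_rfl)) g
    refine ⟨ξ, ?_⟩
    have h1 := hξ (Submodule.Quotient.mk 1)
    have h2 : (LinearMap.ker t).liftQ t le_rfl (Submodule.Quotient.mk 1) = x := by
      rw [Submodule.liftQ_apply]
      simp [t]
    rw [h2] at h1
    rw [h1]
    intro h0
    have h3 : i (Pi.single m' (Submodule.Quotient.mk 1)) = 0 := congrArg Subtype.val h0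
    have h4 : (Pi.single m' (Submodule.Quotient.mk 1) : B) = 0 := hi (by rw [h3, map_zero])
    have h5 := congrFun h4 m'
    rw [Pi.single_eq_same] at h5
    exact hm.ne_top ((Ideal.eq_top_iff_one _).2 ((Submodule.Quotient.mk_eq_zero _).1 h5))
  · have := IsSimpleModule.nontrivial R V
    obtain ⟨v, hv⟩ := exists_ne (0 : V)
    let t := LinearMap.toSpanSingleton R V v
    have hsurj : Function.Surjective t := IsSimpleModule.toSpanSingleton_surjective R hv
    have hmax : Ideal.IsMaximal (LinearMap.ker t) := IsSimpleModule.ker_toSpanSingleton_isMaximal R hv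
    have hkill : ∀ (f : V →ₗ[R] E), ∀ r ∈ LinearMap.ker t, r • f v = 0 := by
      intro f r hr
      rw [← map_smul]
      have : r • v = 0 := hr
      rw [this, map_zero]
    -- Some nonzero multiple of `f v` lies in the product; the scalar is invertible modulo the
    -- annihilator of `v`, so `f v` lies there too.
    have hS : ∀ f : V →ₗ[R] E, (f v : I) ∈ LinearMap.range i := by
      intro f
      by_cases h0 : (f v : I) = 0
      · rw [h0]; exact zero_mem _
      obtain ⟨r, hr, hr0⟩ := hess _ (f v).2 h0
      have hrm : r ∉ LinearMap.ker t := fun h => hr0 (congrArg Subtype.val (hkill f r h))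
      obtain ⟨s, hs⟩ := hmax.exists_inv hrm
      obtain ⟨z, hz, hsz⟩ := hs
      have h1 : (f v : I) = s • r • (f v : I) := by
        have h2 := congrArg Subtype.val (hkill f z hz)
        have h3 : (s * r + z) • (f v : I) = f v := by rw [hsz, one_smul]
        rw [add_smul] at h3
        simp only [Submodule.coe_smul, ZeroMemClass.coe_zero] at h2
        rw [h2, add_zero, mul_smul] at h3
        exact h3.symm
      rw [h1]
      exact Submodule.smul_mem _ _ hr
    let e := LinearEquiv.ofInjective i hi
    let m : MaximalSpectrum R := ⟨LinearMap.ker t, hmax⟩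
    let ψ : (V →ₗ[R] E) →ₗ[R] (R ⧸ m.asIdeal) :=
      LinearMap.proj m ∘ₗ e.symm.toLinearMap ∘ₗ
        (E.subtype ∘ₗ LinearMap.applyₗ v).codRestrict (LinearMap.range i) hS
    have : IsSimpleModule R (R ⧸ m.asIdeal) := isSimpleModule_iff_isCoatom.2 m.isMaximal.out
    rw [← Module.length_eq_one R (R ⧸ m.asIdeal)]
    refine Module.length_le_of_injective ψ ?_
    rw [← LinearMap.ker_eq_bot, LinearMap.ker_eq_bot']
    intro f hf
    obtain ⟨b, hb⟩ := hS f
    have hbe : e.symm ⟨(f v : I), hS f⟩ = b := by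
      rw [LinearEquiv.symm_apply_eq]
      exact Subtype.ext hb.symm
    have hbm : b m = 0 := by
      rw [← hbe]; exact hf
    -- At any other maximal ideal some element annihilating `b` acts invertibly, so only the
    -- coordinate at `m` could survive.
    have hb0 : b = 0 := by
      funext m'
      by_cases hmm : m' = m
      · rw [hmm]; exact hbm
      have hne : ¬ (LinearMap.ker t ≤ m'.asIdeal) := fun hle =>
        hmm (MaximalSpectrum.ext (hmax.eq_of_le m'.isMaximal.ne_top hle).symm)
      obtain ⟨r, hr, hrm⟩ := SetLike.not_le_iff_exists.1 hne
      have h1 : r • b = 0 := hi (by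
        rw [map_smul, hb, map_zero]
        exact congrArg Subtype.val (hkill f r hr))
      have h2 : r • b m' = 0 := congrFun h1 m'
      obtain ⟨s, z, hz, hsz⟩ := m'.isMaximal.exists_inv hrm
      obtain ⟨c, hc⟩ := Submodule.Quotient.mk_surjective _ (b m')
      rw [← hc] at h2 ⊢
      rw [← Submodule.Quotient.mk_smul, Submodule.Quotient.mk_eq_zero, smul_eq_mul] at h2
      rw [Pi.zero_apply, Submodule.Quotient.mk_eq_zero]
      have : c = s * (r * c) + c * z := by linear_combination (-c) * hsz
      rw [this]
      exact add_mem (Ideal.mul_mem_left _ _ h2) (Ideal.mul_mem_left _ _ hz)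
    have hfv : f v = 0 := Subtype.ext (by rw [← hb, hb0, map_zero]; rfl)
    ext w
    obtain ⟨r, rfl⟩ := hsurj w
    simp [t, hfv]

namespace IsDualizingModule

variable {E : Type u} [AddCommGroup E] [Module R E]

/-- Dualizing a composition series stays exact since `E` is injective, and each simple factor
contributes at most one. The inequality alone suffices: applied twice it bounds the bidual. -/
theorem length_dual_le (hE : IsDualizingModule R E) {N : Type u} [AddCommGroup N] [Module R N]
    (hN : IsFiniteLength R N) : Module.length R (N →ₗ[R] E) ≤ Module.length R N := by
  induction hN with
  | of_subsingleton => rw [Module.length_eq_zero (M := _ →ₗ[R] E)]; exact zero_le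
  | @of_simple_quotient N _ _ S _ _ ih =>
    rw [Module.length_eq_add_of_exact (LinearMap.lcomp R E S.mkQ) (LinearMap.lcomp R E S.subtype)
      (fun f g h => LinearMap.ext fun x => by
        obtain ⟨y, rfl⟩ := S.mkQ_surjective x
        exact LinearMap.congr_fun h y)
      (fun g => by
        obtain ⟨h, hh⟩ := hE.injective.out S.subtype S.injective_subtype g
        exact ⟨h, LinearMap.ext hh⟩)
      (fun g => ⟨fun h => ⟨S.liftQ g fun x hx => LinearMap.congr_fun h ⟨x, hx⟩,
        by ext; rfl⟩, by
          rintro ⟨g, rfl⟩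
          ext x
          have : S.mkQ x = 0 := by simp
          change g (S.mkQ x) = 0
          rw [this, map_zero]⟩),
      Module.length_eq_add_of_exact S.subtype S.mkQ S.injective_subtype S.mkQ_surjective
        (by rw [LinearMap.exact_iff]; simp), add_comm]
    refine add_le_add ih ((hE.length_hom_le _).trans ?_)
    rw [Module.length_eq_one]

variable [IsArtinianRing R]

theorem isFiniteLength_of_finite (N : Type u) [AddCommGroup N] [Module R N]
    [Module.Finite R N] : IsFiniteLength R N :=
  isFiniteLength_iff_isNoetherian_isArtinian.2 ⟨inferInstance, inferInstance⟩

theorem finite_dual (hE : IsDualizingModule R E) (N : Type u) [AddCommGroup N] [Module R N]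
    [Module.Finite R N] : Module.Finite R (N →ₗ[R] E) := by
  have hN := isFiniteLength_of_finite (R := R) N
  have h := isFiniteLength_iff_isNoetherian_isArtinian.1 (Module.length_ne_top_iff.1
    (ne_top_of_le_ne_top (Module.length_ne_top_iff.2 hN) (hE.length_dual_le hN)))
  have := h.1
  infer_instance

/-- Finitely generated modules over an artinian ring are reflexive. -/
theorem exists_eval_eq (hE : IsDualizingModule R E) {N : Type u} [AddCommGroup N] [Module R N]
    [Module.Finite R N] (θ : (N →ₗ[R] E) →ₗ[R] E) : ∃ x : N, ∀ ξ : N →ₗ[R] E, θ ξ = ξ x := by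
  let ev : N →ₗ[R] (N →ₗ[R] E) →ₗ[R] E := LinearMap.applyₗ
  have hinj : Function.Injective ev := by
    rw [← LinearMap.ker_eq_bot, LinearMap.ker_eq_bot']
    intro x hx
    by_contra hx0
    obtain ⟨ξ, hξ⟩ := hE.exists_ne_zero N x hx0
    exact hξ (LinearMap.congr_fun hx ξ)
  have := hE.finite_dual N
  have := hE.finite_dual (N →ₗ[R] E)
  have hle : Module.length R ((N →ₗ[R] E) →ₗ[R] E) ≤ Module.length R N :=
    (hE.length_dual_le (isFiniteLength_of_finite _)).trans
      (hE.length_dual_le (isFiniteLength_of_finite _))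
  have htop : LinearMap.range ev = ⊤ := by
    by_contra hne
    have h1 := Submodule.length_lt hne
    rw [← (LinearEquiv.ofInjective ev hinj).length_eq] at h1
    exact absurd hle (not_le.2 h1)
  obtain ⟨x, hx⟩ := (LinearMap.range_eq_top.1 htop) θ
  exact ⟨x, fun ξ => by rw [← hx]; rfl⟩

end IsDualizingModule

end DualizingModule

/-! ### Functionals on endomorphism rings and products of modules. -/

section ArtinAlgebra

variable {R : Type u} [CommRing R] [IsArtinianRing R] {E : Type u} [AddCommGroup E] [Module R E]
  {Λ : Type u} [Ring Λ] [Algebra R Λ]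

/-- A tuple of functionals on `X` that satisfies the relations among the generators `ξ i` of the
dual of `N` comes from a `Λ`-linear map `X → N`. -/
theorem exists_linearMap_of_relations (hE : IsDualizingModule R E)
    {N : Type u} [AddCommGroup N] [Module R N] [Module Λ N] [IsScalarTower R Λ N]
    [Module.Finite R N] {a : ℕ} (ξ : Fin a → (N →ₗ[R] E)) (q : (Fin a → Λ) →ₗ[R] (N →ₗ[R] E))
    (hq : ∀ r n, q r n = ∑ i, ξ i (r i • n)) (hqs : Function.Surjective q)
    {X : Type u} [AddCommGroup X] [Module R X] [Module Λ X] [IsScalarTower R Λ X]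
    (η : (Fin a → X) →ₗ[R] E)
    (hη : ∀ r, q r = 0 → ∀ x : X, η (fun i => r i • x) = 0) :
    ∃ g : X →ₗ[Λ] N, ∀ x : Fin a → X, η x = ∑ i, ξ i (g (x i)) := by
  -- For fixed x the right-hand side kills the relations, so it is a functional on the dual of `N`,
  -- hence evaluation at a point by reflexivity.
  have key : ∀ x : X, ∃ n : N, ∀ r, q r n = η (fun i => r i • x) := by
    intro x
    let sx : (Fin a → Λ) →ₗ[R] (Fin a → X) :=
      { toFun := fun r i => r i • x
        map_add' := fun r s => by funext i; simp [add_smul]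
        map_smul' := fun c r => by funext i; simp }
    let θ : (N →ₗ[R] E) →ₗ[R] E :=
      ((LinearMap.ker q).liftQ (η ∘ₗ sx) fun r hr => hη r hr x) ∘ₗ
        (q.quotKerEquivOfSurjective hqs).symm.toLinearMap
    obtain ⟨n, hn⟩ := hE.exists_eval_eq θ
    refine ⟨n, fun r => ?_⟩
    rw [← hn]
    have : (q.quotKerEquivOfSurjective hqs).symm (q r) = Submodule.Quotient.mk r := by
      rw [LinearEquiv.symm_apply_eq]; rfl
    simp only [θ, LinearMap.comp_apply, LinearEquiv.coe_coe, this]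
    rfl
  -- Uniqueness of that point is what makes x ↦ n linear over `Λ`.
  have sep : ∀ n n' : N, (∀ r, q r n = q r n') → n = n' := by
    intro n n' h
    by_contra hne
    obtain ⟨ζ, hζ⟩ := hE.exists_ne_zero N (n - n') (sub_ne_zero.2 hne)
    obtain ⟨r, rfl⟩ := hqs ζ
    exact hζ (by rw [map_sub, h, sub_self])
  choose g hg using key
  let g' : X →ₗ[Λ] N :=
    { toFun := g
      map_add' := fun x y => sep _ _ fun r => by
        rw [map_add, hg, hg, hg, ← map_add]
        congr 1
        funext i
        simp
      map_smul' := fun μ x => sep _ _ fun r => by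
        have h1 := hg x (fun i => r i * μ)
        rw [hq] at h1
        rw [hg, hq]
        simp only [mul_smul] at h1
        exact h1.symm }
  refine ⟨g', fun x => ?_⟩
  conv_lhs => rw [← LinearMap.sum_single_apply (fun _ : Fin a => X) x]
  rw [map_sum]
  refine Finset.sum_congr rfl fun i _ => ?_
  have h1 := hg (x i) (Pi.single i 1)
  rw [hq, Finset.sum_eq_single i (fun k _ hk => by simp [Pi.single_eq_of_ne hk]) (by simp),
    Pi.single_eq_same, one_smul] at h1
  rw [show g' (x i) = g (x i) from rfl, h1]
  congr 1
  funext k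
  by_cases hk : k = i
  · subst hk; simp
  · simp [Pi.single_eq_of_ne hk]

/-- A functional on the endomorphisms of a finitely generated module `N` that vanishes on the
endomorphisms factoring through some `f j : N → Y j` vanishes on those factoring through the
induced map from `N` to the product. -/
theorem functional_comp_pi_eq_zero [Module.Finite R Λ] (hE : IsDualizingModule R E)
    {N : Type u} [AddCommGroup N] [Module R N] [Module Λ N] [IsScalarTower R Λ N]
    [Module.Finite R N] (lam : Module.End Λ N →ₗ[R] E) {ι : Type u} {Y : ι → Type u}
    [∀ j, AddCommGroup (Y j)] [∀ j, Module R (Y j)] [∀ j, Module Λ (Y j)]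
    [∀ j, IsScalarTower R Λ (Y j)] (f : ∀ j, N →ₗ[Λ] Y j)
    (hf : ∀ j (g : Y j →ₗ[Λ] N), lam (g ∘ₗ f j) = 0) (g : (∀ j, Y j) →ₗ[Λ] N) :
    lam (g ∘ₗ LinearMap.pi f) = 0 := by
  have := hE.finite_dual N
  obtain ⟨a, p, hp⟩ := Module.Finite.exists_fin' R (N →ₗ[R] E)
  let ξ : Fin a → (N →ₗ[R] E) := fun i => p (Pi.single i 1)
  -- the action of `Λ` on functionals
  let act : Λ →ₗ[R] (N →ₗ[R] N) := (Algebra.lsmul R R N).toLinearMap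
  let q : (Fin a → Λ) →ₗ[R] (N →ₗ[R] E) :=
    LinearMap.lsum R (fun _ => Λ) R fun i => (LinearMap.llcomp R N N E (ξ i)) ∘ₗ act
  have hq : ∀ r n, q r n = ∑ i, ξ i (r i • n) := by
    intro r n
    simp [q, act, LinearMap.sum_apply]
  have hqs : Function.Surjective q := by
    intro η
    obtain ⟨c, rfl⟩ := hp η
    refine ⟨fun i => algebraMap R Λ (c i), LinearMap.ext fun n => ?_⟩
    rw [hq]
    have hc : p c = ∑ i, c i • ξ i := by
      conv_lhs => rw [← LinearMap.sum_single_apply (fun _ : Fin a => R) c]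
      rw [map_sum]
      refine Finset.sum_congr rfl fun i _ => ?_
      rw [← map_smul, ← Pi.single_smul, smul_eq_mul, mul_one]
    rw [hc, LinearMap.sum_apply]
    simp
  -- A finite presentation of the dual DN: the `r s` generate the relations among the `ξ i`, and
  -- their number does not depend on the index j.
  obtain ⟨b, r, hr⟩ := Submodule.fg_iff_exists_fin_generating_family.1
    (IsNoetherian.noetherian (LinearMap.ker q))
  have hr0 : ∀ s, q (r s) = 0 := fun s =>
    LinearMap.mem_ker.1 (hr ▸ Submodule.subset_span ⟨s, rfl⟩)
  let Φ : Module.End Λ N →ₗ[R] ((Fin a → N) →ₗ[R] E) :=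
    { toFun := fun h => ∑ i, ξ i ∘ₗ h.restrictScalars R ∘ₗ LinearMap.proj i
      map_add' := fun h h' => by ext; simp [Finset.sum_add_distrib]
      map_smul' := fun c h => by ext; simp [Finset.smul_sum] }
  have hΦ : ∀ h x, Φ h x = ∑ i, ξ i (h (x i)) := fun h x => by simp [Φ]
  have hΦinj : Function.Injective Φ := by
    rw [← LinearMap.ker_eq_bot, LinearMap.ker_eq_bot']
    intro h hh
    ext n
    by_contra hne
    obtain ⟨ζ, hζ⟩ := hE.exists_ne_zero N (h n) hne
    obtain ⟨c, rfl⟩ := hqs ζ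
    refine hζ ?_
    have h1 := LinearMap.congr_fun hh (fun i => c i • n)
    rw [hΦ] at h1
    rw [hq]
    simpa using h1
  -- Injectivity of `E` extends `lam` along `Φ`, and reflexivity turns the extension into evaluation
  -- at a tuple `t`. In effect `lam` is the tensor Σ ξ_i ⊗ t_i in DN ⊗ N.
  obtain ⟨lam', hlam'⟩ := hE.injective.out Φ hΦinj lam
  obtain ⟨t, ht⟩ := hE.exists_eval_eq lam'
  have hlam : ∀ h, lam h = ∑ i, ξ i (h (t i)) := fun h => by rw [← hlam', ht, hΦ]
  -- This is the vanishing of Σ ξ_i ⊗ f_j(t_i) in DN ⊗ Y_j, written with generators and relations.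
  -- If it failed, a separating functional would come from some `h : Y j → N` with `lam (h ∘ f j)`
  -- nonzero.
  have hex : ∀ j, ∃ y : Fin b → Y j, ∀ i, ∑ s, r s i • y s = f j (t i) := by
    intro j
    let L : (Fin b → Y j) →ₗ[R] (Fin a → Y j) :=
      { toFun := fun y i => ∑ s, r s i • y s
        map_add' := fun y y' => by funext i; simp [Finset.sum_add_distrib]
        map_smul' := fun c y => by
          funext i
          simp only [Pi.smul_apply, RingHom.id_apply, Finset.smul_sum]
          exact Finset.sum_congr rfl fun s _ => smul_comm _ _ _ }
    by_contra hno
    have hmem : (fun i => f j (t i)) ∉ LinearMap.range L := by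
      rintro ⟨y, hy⟩
      exact hno ⟨y, fun i => congrFun hy i⟩
    obtain ⟨ζ, hζ⟩ := hE.exists_ne_zero _ ((LinearMap.range L).mkQ fun i => f j (t i))
      (by simpa using hmem)
    obtain ⟨h, hh⟩ := exists_linearMap_of_relations hE ξ q hq hqs
      (ζ ∘ₗ (LinearMap.range L).mkQ) (by
        intro c hc x
        have hc' : c ∈ Submodule.span R (Set.range r) := hr ▸ hc
        obtain ⟨d, rfl⟩ := (Submodule.mem_span_range_iff_exists_fun R).1 hc'
        have : (fun i => (∑ s, d s • r s) i • x) = L (fun s => d s • x) := by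
          funext i
          simp only [L, LinearMap.coe_mk, AddHom.coe_mk, Finset.sum_apply, Finset.sum_smul,
            Pi.smul_apply]
          exact Finset.sum_congr rfl fun s _ => by rw [smul_assoc, smul_comm]
        rw [this, LinearMap.comp_apply]
        have h0 : (LinearMap.range L).mkQ (L fun s => d s • x) = 0 := by simp
        rw [h0, map_zero])
    refine hζ ((hh _).trans ?_)
    rw [← hf j h, hlam]
    rfl
  choose y hy using hex
  rw [hlam]
  -- As all j use the same `r s`, the solutions assemble to one in the product.
  have h1 : ∀ i, LinearMap.pi f (t i) = ∑ s, r s i • (fun j => y j s) := by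
    intro i
    funext j
    simp [← hy j i]
  simp only [LinearMap.comp_apply, h1, map_sum, map_smul]
  rw [Finset.sum_comm]
  refine Finset.sum_eq_zero fun s _ => ?_
  rw [← hq, hr0, LinearMap.zero_apply]

end ArtinAlgebra

/-! ### Split monomorphisms into products. -/

section SplitMono

variable {Λ : Type u} [Ring Λ]

theorem mem_jacobson_of_isNilpotent_mul {A : Type u} [Ring A] {x : A}
    (hx : ∀ y : A, IsNilpotent (y * x)) : x ∈ Ideal.jacobson (⊥ : Ideal A) := by
  rw [Ideal.mem_jacobson_iff]
  intro y
  obtain ⟨z, hz⟩ := (hx y).isUnit_add_one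
  refine ⟨((z⁻¹ : Aˣ) : A), ?_⟩
  have : ((z⁻¹ : Aˣ) : A) * (y * x + 1) = 1 := by rw [← hz, Units.inv_mul]
  rw [Ideal.mem_bot, ← this]
  noncomm_ring

/-- A module with local endomorphism ring that is a direct summand of a product via maps `f j` is
a direct summand of one of the factors. -/
theorem comp_pi_ne_id [IsArtinAlgebra Λ] {N : Type u} [AddCommGroup N] [Module Λ N]
    [Module.Finite Λ N] [Nontrivial N] (hN : ∀ x : Module.End Λ N, IsUnit x ∨ IsNilpotent x)
    {ι : Type u} {Y : ι → Type u} [∀ j, AddCommGroup (Y j)] [∀ j, Module Λ (Y j)]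
    (f : ∀ j, N →ₗ[Λ] Y j) (hf : ∀ j (g : Y j →ₗ[Λ] N), g ∘ₗ f j ≠ LinearMap.id)
    (g : (∀ j, Y j) →ₗ[Λ] N) : g ∘ₗ LinearMap.pi f ≠ LinearMap.id := by
  obtain ⟨R, _, _, _, _⟩ := IsArtinAlgebra.exists_base (Λ := Λ)
  obtain ⟨E, _, _, hE⟩ := exists_isDualizingModule R
  let : Module R N := Module.compHom N (algebraMap R Λ)
  let : ∀ j, Module R (Y j) := fun j => Module.compHom (Y j) (algebraMap R Λ)
  have tower : ∀ (X : Type u) [AddCommGroup X] [Module Λ X],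
      letI : Module R X := Module.compHom X (algebraMap R Λ)
      IsScalarTower R Λ X := fun X _ _ => by
    let _ : Module R X := Module.compHom X (algebraMap R Λ)
    exact ⟨fun r a x => by
      rw [Algebra.smul_def, mul_smul]; rfl⟩
  have : IsScalarTower R Λ N := tower N
  have : ∀ j, IsScalarTower R Λ (Y j) := fun j => tower (Y j)
  have : Module.Finite R N := Module.Finite.trans Λ N
  let J : Submodule R (Module.End Λ N) :=
    (Ideal.jacobson (⊥ : Ideal (Module.End Λ N))).restrictScalars R
  have hJ : (1 : Module.End Λ N) ∉ J := fun h =>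
    bot_ne_top (Ideal.jacobson_eq_top_iff.1 ((Ideal.eq_top_iff_one _).2 h))
  obtain ⟨ζ, hζ⟩ := hE.exists_ne_zero _ (J.mkQ 1) (by simpa using hJ)
  intro h1
  refine hζ ?_
  -- The functional kills the radical but not the identity. An endomorphism through a single `f j`
  -- lies in the radical, since an invertible multiple of it would split `f j`.
  have h2 := functional_comp_pi_eq_zero hE (ζ ∘ₗ J.mkQ) f (fun j k => by
    have hmem : k ∘ₗ f j ∈ J := by
      refine mem_jacobson_of_isNilpotent_mul fun y => ?_
      refine (hN (y * (k ∘ₗ f j))).resolve_left ?_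
      rintro ⟨z, hz⟩
      refine hf j (((z⁻¹ : (Module.End Λ N)ˣ) : Module.End Λ N) ∘ₗ y ∘ₗ k) ?_
      have h3 : ((z⁻¹ : (Module.End Λ N)ˣ) : Module.End Λ N) * (y * (k ∘ₗ f j)) = 1 := by
        rw [← hz, Units.inv_mul]
      exact h3
    have h0 : J.mkQ (k ∘ₗ f j) = 0 := by simpa using hmem
    rw [LinearMap.comp_apply, h0, map_zero]) g
  rw [h1] at h2
  exact h2

end SplitMono

end ClusterTilting

namespace ClusterTilting

/-! ### Local factorization and pure monomorphisms. -/

section Pure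

variable {Λ : Type u} [Ring Λ]

/-- Every map from a finitely generated module to `X` factors through a module in `P`. -/
def LocallyFactors (P : ObjectProperty (ModuleCat.{u} Λ)) (X : Type u) [AddCommGroup X]
    [Module Λ X] : Prop :=
  ∀ (A : Type u) [AddCommGroup A] [Module Λ A] [Module.Finite Λ A] (f : A →ₗ[Λ] X),
    ∃ Y : ModuleCat.{u} Λ, P Y ∧ ∃ (g : A →ₗ[Λ] Y) (h : Y →ₗ[Λ] X), h ∘ₗ g = f

/-- `φ` is a pure monomorphism: finite systems of linear equations over `D` that are solvable in
`X` are solvable in `D`. -/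
def IsPureMap {D X : Type u} [AddCommGroup D] [Module Λ D] [AddCommGroup X] [Module Λ X]
    (φ : D →ₗ[Λ] X) : Prop :=
  ∀ (L Z : Type u) [AddCommGroup L] [Module Λ L] [Module.Finite Λ L] [AddCommGroup Z] [Module Λ Z]
    [Module.Finite Λ Z] (a : L →ₗ[Λ] D) (j : L →ₗ[Λ] Z) (b : Z →ₗ[Λ] X),
    b ∘ₗ j = φ ∘ₗ a → ∃ c : Z →ₗ[Λ] D, c ∘ₗ j = a

variable {D X : Type u} [AddCommGroup D] [Module Λ D] [AddCommGroup X] [Module Λ X]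

theorem IsPureMap.injective {φ : D →ₗ[Λ] X} (hφ : IsPureMap φ) : Function.Injective φ := by
  rw [← LinearMap.ker_eq_bot, LinearMap.ker_eq_bot']
  intro x hx
  obtain ⟨c, hc⟩ := hφ Λ PUnit (LinearMap.toSpanSingleton Λ D x) 0 0 (by ext; simp [hx])
  have := LinearMap.congr_fun hc 1
  simpa using this.symm

/-- Maps from finitely generated modules lift along pure epimorphisms. -/
theorem IsPureMap.exists_lift [IsNoetherianRing Λ] {φ : D →ₗ[Λ] X} (hφ : IsPureMap φ)
    {N : Type u} [AddCommGroup N] [Module Λ N] [Module.Finite Λ N]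
    (f : N →ₗ[Λ] X ⧸ LinearMap.range φ) :
    ∃ f' : N →ₗ[Λ] X, (LinearMap.range φ).mkQ ∘ₗ f' = f := by
  obtain ⟨m, p, hp⟩ := Module.Finite.exists_fin' Λ N
  obtain ⟨b, hb⟩ := Module.projective_lifting_property (LinearMap.range φ).mkQ (f ∘ₗ p)
    (Submodule.mkQ_surjective _)
  have hmem : ∀ x : LinearMap.ker p, (b ∘ₗ (LinearMap.ker p).subtype) x ∈ LinearMap.range φ := by
    intro x
    have h1 := LinearMap.congr_fun hb x
    have hx : p x = 0 := x.2
    rw [LinearMap.comp_apply, LinearMap.comp_apply, hx, map_zero] at h1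
    exact (Submodule.Quotient.mk_eq_zero _).1 h1
  let e := LinearEquiv.ofInjective φ hφ.injective
  let a : LinearMap.ker p →ₗ[Λ] D :=
    e.symm.toLinearMap ∘ₗ (b ∘ₗ (LinearMap.ker p).subtype).codRestrict _ hmem
  have ha : ∀ x, φ (a x) = b x := fun x => congrArg Subtype.val (e.apply_symm_apply ⟨_, hmem x⟩)
  -- Purity extends `a` from the finitely generated kernel to the free module, so that `b - φ ∘ c`
  -- vanishes on the kernel and descends to `N`.
  obtain ⟨c, hc⟩ := hφ _ _ a (LinearMap.ker p).subtype b (by ext x; exact (ha x).symm)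
  refine ⟨(LinearMap.ker p).liftQ (b - φ ∘ₗ c) (fun x hx => ?_) ∘ₗ
    (p.quotKerEquivOfSurjective hp).symm.toLinearMap, ?_⟩
  · have h1 := LinearMap.congr_fun hc ⟨x, hx⟩
    simp only [LinearMap.comp_apply, Submodule.subtype_apply] at h1
    rw [LinearMap.mem_ker, LinearMap.sub_apply, LinearMap.comp_apply, h1, ha, sub_self]
  · ext n
    obtain ⟨y, rfl⟩ := hp n
    have h1 : (p.quotKerEquivOfSurjective hp).symm (p y) = Submodule.Quotient.mk y := by
      rw [LinearEquiv.symm_apply_eq]; rfl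
    have h2 := LinearMap.congr_fun hb y
    simp only [LinearMap.comp_apply] at h2
    simp only [LinearMap.comp_apply, LinearEquiv.coe_coe, h1]
    rw [Submodule.liftQ_apply, LinearMap.sub_apply, map_sub, h2, sub_eq_self]
    simp

theorem LocallyFactors.quotient [IsNoetherianRing Λ] {P : ObjectProperty (ModuleCat.{u} Λ)}
    {φ : D →ₗ[Λ] X} (hφ : IsPureMap φ) (hX : LocallyFactors P X) :
    LocallyFactors P (X ⧸ LinearMap.range φ) := by
  intro A _ _ _ f
  obtain ⟨f', rfl⟩ := hφ.exists_lift f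
  obtain ⟨Y, hY, g, h, rfl⟩ := hX A f'
  exact ⟨Y, hY, g, (LinearMap.range φ).mkQ ∘ₗ h, rfl⟩

theorem LocallyFactors.of_retract {P : ObjectProperty (ModuleCat.{u} Λ)}
    (hX : LocallyFactors P X) (s : D →ₗ[Λ] X) (r : X →ₗ[Λ] D) (h : r ∘ₗ s = LinearMap.id) :
    LocallyFactors P D := by
  intro A _ _ _ f
  obtain ⟨Y, hY, g, k, hk⟩ := hX A (s ∘ₗ f)
  refine ⟨Y, hY, g, r ∘ₗ k, ?_⟩
  rw [LinearMap.comp_assoc, hk, ← LinearMap.comp_assoc, h, LinearMap.id_comp]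

theorem LocallyFactors.of_prop {P : ObjectProperty (ModuleCat.{u} Λ)} {Y : ModuleCat.{u} Λ}
    (hY : P Y) : LocallyFactors P Y :=
  fun _ _ _ _ f => ⟨Y, hY, f, LinearMap.id, LinearMap.id_comp f⟩

end Pure

/-! ### Finite subsums, and direct sums as pure submodules of products. -/

section DirectSum

variable {Λ : Type u} [Ring Λ] {ι : Type u} (Y : ι → Type u) [∀ k, AddCommGroup (Y k)]
  [∀ k, Module Λ (Y k)]

/-- The inclusion of a finite subsum. -/
noncomputable def finsetIncl (F : Finset ι) : (∀ k : F, Y k) →ₗ[Λ] DirectSum ι Y := by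
  classical
  exact ∑ k : F, DirectSum.lof Λ ι Y k ∘ₗ LinearMap.proj k

/-- The projection onto a finite subsum. -/
noncomputable def finsetProj (F : Finset ι) : DirectSum ι Y →ₗ[Λ] (∀ k : F, Y k) :=
  LinearMap.pi fun k => DirectSum.component Λ ι Y k

/-- The embedding of the direct sum into the product. -/
noncomputable def sumToPi : DirectSum ι Y →ₗ[Λ] (∀ k, Y k) :=
  LinearMap.pi fun k => DirectSum.component Λ ι Y k

variable {Y}

theorem finsetIncl_apply (F : Finset ι) (y : ∀ k : F, Y k) (k : ι) :
    (finsetIncl (Λ := Λ) Y F y) k = open Classical in if h : k ∈ F then y ⟨k, h⟩ else 0 := by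
  classical
  have h1 : (finsetIncl (Λ := Λ) Y F y) k = ∑ l : F, DirectSum.component Λ ι Y k
      (DirectSum.lof Λ ι Y l (y l)) := by
    change DirectSum.component Λ ι Y k _ = _
    simp [finsetIncl, LinearMap.sum_apply]
  rw [h1]
  split_ifs with h
  · rw [Finset.sum_eq_single ⟨k, h⟩]
    · exact DirectSum.component.lof_self Λ k (y ⟨k, h⟩)
    · rintro l - hl
      rw [DirectSum.component.of, dif_neg]
      exact fun hlk => hl (Subtype.ext hlk)
    · simp
  · refine Finset.sum_eq_zero fun l _ => ?_
    rw [DirectSum.component.of, dif_neg]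
    rintro rfl
    exact h l.2

theorem finsetIncl_finsetProj_apply {F : Finset ι} {z : DirectSum ι Y}
    (hz : ∀ k, k ∉ F → z k = 0) :
    finsetIncl (Λ := Λ) Y F (finsetProj (Λ := Λ) Y F z) = z := by
  refine DFinsupp.ext fun k => ?_
  rw [finsetIncl_apply]
  split_ifs with h
  · rfl
  · exact (hz k h).symm

/-- A map from a finitely generated module to a direct sum lands in a finite subsum. -/
theorem exists_finset_comp_eq {A : Type u} [AddCommGroup A] [Module Λ A] [Module.Finite Λ A]
    (f : A →ₗ[Λ] DirectSum ι Y) :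
    ∃ F : Finset ι, finsetIncl Y F ∘ₗ finsetProj Y F ∘ₗ f = f := by
  classical
  obtain ⟨S, hS⟩ := Module.Finite.fg_top (R := Λ) (M := A)
  refine ⟨S.biUnion fun a => DFinsupp.support (f a), LinearMap.ext_on hS fun a ha => ?_⟩
  refine finsetIncl_finsetProj_apply fun k hk => ?_
  by_contra h
  exact hk (Finset.mem_biUnion.2 ⟨a, ha, DFinsupp.mem_support_iff.2 h⟩)

/-- A finitely generated source reaches only finitely many coordinates, so truncating a solution in
the product to these gives one in the sum. -/
theorem isPureMap_sumToPi : IsPureMap (sumToPi (Λ := Λ) Y) := by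
  intro L Z _ _ _ _ _ _ a j b h
  obtain ⟨F, hF⟩ := exists_finset_comp_eq a
  refine ⟨finsetIncl Y F ∘ₗ LinearMap.pi (fun k => LinearMap.proj (k : ι)) ∘ₗ b, ?_⟩
  rw [LinearMap.comp_assoc, LinearMap.comp_assoc, h]
  exact hF

end DirectSum

/-! ### Fitting's lemma and Krull–Schmidt decompositions. -/

section FiniteLength

variable {Λ : Type u} [Ring Λ]

/-- A nonzero module all of whose endomorphisms are invertible or nilpotent. -/
def IsLocalModule (Λ : Type u) [Ring Λ] (N : Type u) [AddCommGroup N] [Module Λ N] : Prop :=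
  Nontrivial N ∧ ∀ x : Module.End Λ N, IsUnit x ∨ IsNilpotent x

/-- Fitting: for large k the module is the direct sum of kernel and image of x^k, and x is bijective
on the image. The retraction in the conclusion lets a factorization of x exhibit the image as a
summand of the intermediate module. -/
theorem exists_retract_of_not_isNilpotent {N : Type u} [AddCommGroup N] [Module Λ N]
    [IsNoetherian Λ N] [IsArtinian Λ N] {x : Module.End Λ N} (hx : ¬ IsNilpotent x) :
    ∃ (S : Submodule Λ N), S ≠ ⊥ ∧ (S = ⊤ → IsUnit x) ∧ (∃ T, IsCompl S T) ∧
      ∃ r : N →ₗ[Λ] S, r ∘ₗ x ∘ₗ S.subtype = LinearMap.id := by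
  obtain ⟨k, hk, hk1⟩ := ((LinearMap.eventually_isCompl_ker_pow_range_pow x).and
    (Filter.eventually_ge_atTop 1)).exists
  have hmaps : ∀ y ∈ LinearMap.range (x ^ k), x y ∈ LinearMap.range (x ^ k) := by
    rintro _ ⟨z, rfl⟩
    exact ⟨x z, by rw [← Module.End.mul_apply, ← Module.End.mul_apply, ← pow_succ, pow_succ']⟩
  have hker : ∀ y ∈ LinearMap.range (x ^ k), x y = 0 → y = 0 := by
    intro y hy hxy
    refine Submodule.disjoint_def.1 hk.disjoint y ?_ hy
    rw [LinearMap.mem_ker]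
    obtain ⟨l, rfl⟩ := Nat.exists_eq_add_of_le hk1
    rw [add_comm, pow_succ, Module.End.mul_apply, hxy, map_zero]
  let x' : LinearMap.range (x ^ k) →ₗ[Λ] LinearMap.range (x ^ k) :=
    (x ∘ₗ (LinearMap.range (x ^ k)).subtype).codRestrict _ fun y => hmaps _ y.2
  have hinj : Function.Injective x' := by
    rw [← LinearMap.ker_eq_bot, LinearMap.ker_eq_bot']
    intro y hy
    exact Subtype.ext (hker _ y.2 (congrArg Subtype.val hy))
  let e := LinearEquiv.ofBijective x'
    ⟨hinj, IsArtinian.surjective_of_injective_endomorphism x' hinj⟩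
  refine ⟨LinearMap.range (x ^ k), fun h => hx ⟨k, LinearMap.range_eq_bot.1 h⟩, fun h => ?_,
    ⟨_, hk.symm⟩,
    e.symm.toLinearMap ∘ₗ Submodule.projectionOnto _ _ hk.symm, ?_⟩
  · have hxi : Function.Injective x := by
      rw [← LinearMap.ker_eq_bot, LinearMap.ker_eq_bot']
      exact fun y hy => hker y (h ▸ Submodule.mem_top) hy
    exact (Module.End.isUnit_iff x).2
      ⟨hxi, IsArtinian.surjective_of_injective_endomorphism x hxi⟩
  · ext y
    simp only [LinearMap.comp_apply, LinearEquiv.coe_coe, LinearMap.id_apply]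
    congr 1
    rw [LinearEquiv.symm_apply_eq]
    exact Submodule.projectionOnto_apply_left hk.symm (x' y)

/-- A module of finite length is a finite direct sum of modules with local endomorphism ring. -/
theorem exists_decomposition (N : Type u) [AddCommGroup N] [Module Λ N]
    [IsNoetherian Λ N] [IsArtinian Λ N] :
    ∃ (κ : Type) (_ : Fintype κ) (Y : κ → ModuleCat.{u} Λ) (s : ∀ i, Y i →ₗ[Λ] N)
      (r : ∀ i, N →ₗ[Λ] Y i), (∀ i, IsLocalModule Λ (Y i)) ∧ (∀ i, r i ∘ₗ s i = LinearMap.id) ∧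
      ∑ i, s i ∘ₗ r i = LinearMap.id := by
  obtain ⟨l, hl⟩ := ENat.ne_top_iff_exists.1 (Module.length_ne_top (R := Λ) (M := N))
  induction l using Nat.strong_induction_on generalizing N with
  | _ l ih =>
    by_cases hN : Nontrivial N
    swap
    · rw [not_nontrivial_iff_subsingleton] at hN
      exact ⟨Empty, inferInstance, Empty.elim, fun i => i.elim, fun i => i.elim,
        fun i => i.elim, fun i => i.elim, LinearMap.ext fun x => Subsingleton.elim _ _⟩
    by_cases hloc : ∀ x : Module.End Λ N, IsUnit x ∨ IsNilpotent x
    · exact ⟨Unit, inferInstance, fun _ => ModuleCat.of Λ N, fun _ => LinearMap.id,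
        fun _ => LinearMap.id, fun _ => ⟨hN, hloc⟩, fun _ => rfl, by simp⟩
    push Not at hloc
    obtain ⟨x, hxu, hxn⟩ := hloc
    obtain ⟨S, hS, hST, ⟨T, hT⟩, -⟩ := exists_retract_of_not_isNilpotent hxn
    have hS' : S ≠ ⊤ := fun h => hxu (hST h)
    have hT' : T ≠ ⊤ := fun h => hS (by
      have := hT.inf_eq_bot
      rwa [h, inf_top_eq] at this)
    have aux : ∀ U : Submodule Λ N, U ≠ ⊤ → ∃ m < l, (m : ℕ∞) = Module.length Λ U := by
      intro U hU
      have h1 := Submodule.length_lt hU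
      obtain ⟨m, hm⟩ := ENat.ne_top_iff_exists.1 (Module.length_ne_top (R := Λ) (M := U))
      rw [← hl, ← hm] at h1
      exact ⟨m, by exact_mod_cast h1, hm⟩
    obtain ⟨m₁, hm₁, hlen₁⟩ := aux S hS'
    obtain ⟨m₂, hm₂, hlen₂⟩ := aux T hT'
    obtain ⟨κ₁, _, Y₁, s₁, r₁, hY₁, hrs₁, hsum₁⟩ := ih m₁ hm₁ S hlen₁
    obtain ⟨κ₂, _, Y₂, s₂, r₂, hY₂, hrs₂, hsum₂⟩ := ih m₂ hm₂ T hlen₂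
    let p := Submodule.projectionOnto S T hT
    let q := Submodule.projectionOnto T S hT.symm
    have hp : p ∘ₗ S.subtype = LinearMap.id :=
      LinearMap.ext fun y => Submodule.projectionOnto_apply_left hT y
    have hq : q ∘ₗ T.subtype = LinearMap.id :=
      LinearMap.ext fun y => Submodule.projectionOnto_apply_left hT.symm y
    refine ⟨κ₁ ⊕ κ₂, inferInstance, Sum.elim Y₁ Y₂,
      fun i => Sum.rec (fun i => S.subtype ∘ₗ s₁ i) (fun i => T.subtype ∘ₗ s₂ i) i,
      fun i => Sum.rec (fun i => r₁ i ∘ₗ p) (fun i => r₂ i ∘ₗ q) i, ?_, ?_, ?_⟩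
    · rintro (i | i)
      exacts [hY₁ i, hY₂ i]
    · rintro (i | i)
      · change (r₁ i ∘ₗ p) ∘ₗ S.subtype ∘ₗ s₁ i = LinearMap.id
        rw [LinearMap.comp_assoc, ← LinearMap.comp_assoc (s₁ i), hp, LinearMap.id_comp, hrs₁]
      · change (r₂ i ∘ₗ q) ∘ₗ T.subtype ∘ₗ s₂ i = LinearMap.id
        rw [LinearMap.comp_assoc, ← LinearMap.comp_assoc (s₂ i), hq, LinearMap.id_comp, hrs₂]
    · rw [Fintype.sum_sum_type]
      ext y
      have h1 := LinearMap.congr_fun hsum₁ (p y)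
      have h2 := LinearMap.congr_fun hsum₂ (q y)
      have h1' := congrArg Subtype.val h1
      have h2' := congrArg Subtype.val h2
      simp only [LinearMap.sum_apply, LinearMap.comp_apply, LinearMap.id_apply,
        AddSubmonoidClass.coe_finsetSum] at h1' h2'
      simp only [LinearMap.add_apply, LinearMap.sum_apply, LinearMap.id_apply]
      refine (congrArg₂ (· + ·) h1' h2').trans ?_
      exact Submodule.projection_add_projection_eq_self hT y

end FiniteLength

end ClusterTilting

namespace ClusterTilting

/-! ### From splitting of large modules to an additive generator. -/

section FiniteType

variable {Λ : Type u} [Ring Λ]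

theorem IsArtinAlgebra.isArtinianRing (Λ : Type u) [Ring Λ] [h : IsArtinAlgebra Λ] :
    IsArtinianRing Λ := by
  obtain ⟨R, _, _, _, _⟩ := h.exists_base
  exact isArtinian_of_tower R (inferInstance : IsArtinian R Λ)

/-- A class of finitely generated modules that contains the finitely generated modules locally
factoring through it and has left approximations. -/
structure IsApproximating (P : ObjectProperty (ModuleCat.{u} Λ)) : Prop where
  finite : ∀ Y, P Y → Module.Finite Λ Y
  of_locallyFactors : ∀ (Y : ModuleCat.{u} Λ) [Module.Finite Λ Y], LocallyFactors P Y → P Y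
  exists_approximation : ∀ (A : Type u) [AddCommGroup A] [Module Λ A] [Module.Finite Λ A],
    ∃ (Y : ModuleCat.{u} Λ) (θ : A →ₗ[Λ] Y), P Y ∧
      ∀ Z : ModuleCat.{u} Λ, P Z → ∀ f : A →ₗ[Λ] Z, ∃ g : Y →ₗ[Λ] Z, g ∘ₗ θ = f

variable {P : ObjectProperty (ModuleCat.{u} Λ)}

theorem IsApproximating.of_retract [IsNoetherianRing Λ] (hP : IsApproximating P)
    {Y : ModuleCat.{u} Λ} (hY : P Y)
    (Z : Type u) [AddCommGroup Z] [Module Λ Z] (s : Z →ₗ[Λ] Y) (r : Y →ₗ[Λ] Z)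
    (h : r ∘ₗ s = LinearMap.id) : P (ModuleCat.of Λ Z) := by
  have := hP.finite Y hY
  have : Module.Finite Λ Z := Module.Finite.of_surjective r fun z => ⟨s z, LinearMap.congr_fun h z⟩
  have : Module.Finite Λ (ModuleCat.of Λ Z) := this
  exact hP.of_locallyFactors _ ((LocallyFactors.of_prop hY).of_retract s r h)

/-- A single left approximation of the source serves all coordinates at once. -/
theorem IsApproximating.locallyFactors_pi (hP : IsApproximating P) {ι : Type u} {Y : ι → Type u}
    [∀ k, AddCommGroup (Y k)] [∀ k, Module Λ (Y k)] (hY : ∀ k, LocallyFactors P (Y k)) :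
    LocallyFactors P (∀ k, Y k) := by
  intro A _ _ _ f
  obtain ⟨W, θ, hW, hθ⟩ := hP.exists_approximation A
  have : ∀ k, ∃ g : W →ₗ[Λ] Y k, g ∘ₗ θ = LinearMap.proj k ∘ₗ f := by
    intro k
    obtain ⟨Z, hZ, a, b, hab⟩ := hY k A (LinearMap.proj k ∘ₗ f)
    obtain ⟨g, rfl⟩ := hθ Z hZ a
    exact ⟨b ∘ₗ g, hab⟩
  choose g hg using this
  refine ⟨W, hW, θ, LinearMap.pi g, LinearMap.ext fun x => funext fun k => ?_⟩
  exact LinearMap.congr_fun (hg k) x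

theorem IsApproximating.locallyFactors_directSum (hP : IsApproximating P) {ι : Type u}
    {Y : ι → Type u} [∀ k, AddCommGroup (Y k)] [∀ k, Module Λ (Y k)]
    (hY : ∀ k, LocallyFactors P (Y k)) : LocallyFactors P (DirectSum ι Y) := by
  intro A _ _ _ f
  obtain ⟨F, hF⟩ := exists_finset_comp_eq f
  obtain ⟨W, hW, g, h, hgh⟩ := hP.locallyFactors_pi (fun k : F => hY k) A (finsetProj Y F ∘ₗ f)
  exact ⟨W, hW, g, finsetIncl Y F ∘ₗ h, by rw [LinearMap.comp_assoc, hgh, hF]⟩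

theorem IsApproximating.locallyFactors_of_addClosure (hP : IsApproximating P)
    {X : ModuleCat.{u} Λ} (hX : AddClosure P X) : LocallyFactors P X := by
  obtain ⟨ι, Y, hY, ⟨ρ⟩⟩ := hX
  refine (hP.locallyFactors_directSum fun k => LocallyFactors.of_prop (hY k)).of_retract
    ρ.i.hom ρ.r.hom ?_
  rw [← ModuleCat.hom_comp, ρ.retract, ModuleCat.hom_id]

/-- A nonzero direct summand of a direct sum of modules of finite length has a direct summand
with local endomorphism ring. -/
theorem exists_isLocalModule_retract [IsArtinAlgebra Λ] (hP : ∀ Y, P Y → Module.Finite Λ Y)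
    {X : ModuleCat.{u} Λ} (hX : AddClosure P X) [Nontrivial X] :
    ∃ (N : ModuleCat.{u} Λ) (s : N →ₗ[Λ] X) (r : X →ₗ[Λ] N), Module.Finite Λ N ∧
      IsLocalModule Λ N ∧ r ∘ₗ s = LinearMap.id := by
  have := IsArtinAlgebra.isArtinianRing Λ
  obtain ⟨ι, Y, hY, ⟨ρ⟩⟩ := hX
  have : ∀ k, Module.Finite Λ (Y k) := fun k => hP _ (hY k)
  let i : X →ₗ[Λ] DirectSum ι fun k => Y k := ρ.i.hom
  let r : (DirectSum ι fun k => Y k) →ₗ[Λ] X := ρ.r.hom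
  have hri : ∀ x, r (i x) = x := fun x => by
    have := congrArg ModuleCat.Hom.hom ρ.retract
    exact LinearMap.congr_fun this x
  obtain ⟨x, hx⟩ := exists_ne (0 : X)
  obtain ⟨F, hF⟩ := exists_finset_comp_eq (i ∘ₗ LinearMap.toSpanSingleton Λ X x)
  let y₀ := finsetProj (Λ := Λ) (fun k => Y k) F (i x)
  have hFx : finsetIncl (Λ := Λ) (fun k => Y k) F y₀ = i x := by
    have := LinearMap.congr_fun hF 1
    simpa using this
  -- This endomorphism factors through `X` and fixes the nonzero element `y₀`, so it is not
  -- nilpotent, and its Fitting summand is a summand of `X`.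
  let a : Module.End Λ (∀ k : F, Y k) :=
    finsetProj (fun k => Y k) F ∘ₗ i ∘ₗ r ∘ₗ finsetIncl (fun k => Y k) F
  have ha : a y₀ = y₀ := by
    simp only [a, LinearMap.comp_apply, hFx, hri]
    rfl
  have hnil : ¬ IsNilpotent a := by
    rintro ⟨k, hk⟩
    have h1 : ∀ l : ℕ, (a ^ l) y₀ = y₀ := by
      intro l
      induction l with
      | zero => rfl
      | succ l ih => rw [pow_succ, Module.End.mul_apply, ha, ih]
    have h2 := h1 k
    rw [hk, LinearMap.zero_apply] at h2
    apply hx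
    rw [← hri x, ← hFx, ← h2, map_zero, map_zero]
  obtain ⟨S, hS, -, -, q, hq⟩ := exists_retract_of_not_isNilpotent hnil
  obtain ⟨κ, _, W, s', r', hloc, hrs, hsum⟩ := exists_decomposition (Λ := Λ) S
  obtain ⟨l⟩ : Nonempty κ := by
    by_contra hne
    rw [not_nonempty_iff] at hne
    rw [Finset.univ_eq_empty, Finset.sum_empty] at hsum
    refine hS ((Submodule.eq_bot_iff _).2 fun y hy => ?_)
    exact (congrArg Subtype.val (LinearMap.congr_fun hsum ⟨y, hy⟩)).symm
  refine ⟨W l, r ∘ₗ finsetIncl (fun k => Y k) F ∘ₗ S.subtype ∘ₗ s' l,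
    r' l ∘ₗ q ∘ₗ finsetProj (fun k => Y k) F ∘ₗ i, ?_, hloc l, ?_⟩
  · exact Module.Finite.of_surjective (r' l) fun z => ⟨s' l z, LinearMap.congr_fun (hrs l) z⟩
  · ext z
    have h1 := LinearMap.congr_fun hq (s' l z)
    have h2 := LinearMap.congr_fun (hrs l) z
    exact (congrArg (r' l) h1).trans h2

theorem IsLocalModule.exists_linearEquiv {N Y : Type u} [AddCommGroup N] [Module Λ N]
    [AddCommGroup Y] [Module Λ Y] (hY : IsLocalModule Λ Y) [Nontrivial N] (s : N →ₗ[Λ] Y)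
    (r : Y →ₗ[Λ] N) (h : r ∘ₗ s = LinearMap.id) : Nonempty (N ≃ₗ[Λ] Y) := by
  have hrs : ∀ x, r (s x) = x := LinearMap.congr_fun h
  have hid : IsIdempotentElem (s ∘ₗ r : Module.End Λ Y) := by
    ext y
    simp [Module.End.mul_apply, hrs]
  rcases hY.2 (s ∘ₗ r) with hu | ⟨k, hk⟩
  · have h1 : (s ∘ₗ r : Module.End Λ Y) = 1 := (IsIdempotentElem.iff_eq_one_of_isUnit hu).1 hid
    exact ⟨LinearEquiv.ofLinearMap s r h1 h⟩
  · exfalso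
    obtain ⟨x, hx⟩ := exists_ne (0 : N)
    have h1 : (s ∘ₗ r : Module.End Λ Y) = 0 := by
      rcases Nat.eq_zero_or_pos k with rfl | hk0
      · rw [pow_zero] at hk
        rw [← mul_one (s ∘ₗ r : Module.End Λ Y), hk, mul_zero]
      · rwa [hid.pow_eq hk0.ne'] at hk
    apply hx
    have h2 := LinearMap.congr_fun h1 (s x)
    rw [LinearMap.comp_apply, hrs, LinearMap.zero_apply] at h2
    rw [← hrs x, h2, map_zero]

/-- A small set of finitely generated modules containing all of them up to isomorphism. -/
def fgModel (x : Σ m : ℕ, Submodule Λ (Fin m → Λ)) : ModuleCat.{u} Λ :=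
  ModuleCat.of Λ ((Fin x.1 → Λ) ⧸ x.2)

theorem exists_fgModel (A : Type u) [AddCommGroup A] [Module Λ A] [Module.Finite Λ A] :
    ∃ x, Nonempty (A ≃ₗ[Λ] fgModel (Λ := Λ) x) := by
  obtain ⟨m, p, hp⟩ := Module.Finite.exists_fin' Λ A
  exact ⟨⟨m, LinearMap.ker p⟩, ⟨(p.quotKerEquivOfSurjective hp).symm⟩⟩

/-- If every module locally factoring through `P` is a direct summand of a direct sum of modules
in `P`, then `P` has an additive generator. -/
theorem IsApproximating.exists_generator [IsArtinAlgebra Λ] (hP : IsApproximating P)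
    (hc : ∀ X : ModuleCat.{u} Λ, LocallyFactors P X → AddClosure P X) :
    ∃ G : ModuleCat.{u} Λ, P G ∧ ∀ Y, P Y → ∃ (m : ℕ) (s : Y →ₗ[Λ] (Fin m → G))
      (r : (Fin m → G) →ₗ[Λ] Y), r ∘ₗ s = LinearMap.id := by
  classical
  have := IsArtinAlgebra.isArtinianRing Λ
  let I := {x : Σ m : ℕ, Submodule Λ (Fin m → Λ) // P (fgModel x) ∧ IsLocalModule Λ (fgModel x)}
  let st : Setoid I :=
    { r := fun x y => Nonempty (fgModel x.1 ≃ₗ[Λ] fgModel y.1)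
      iseqv := ⟨fun _ => ⟨LinearEquiv.refl _ _⟩, fun ⟨e⟩ => ⟨e.symm⟩,
        fun ⟨e⟩ ⟨e'⟩ => ⟨e.trans e'⟩⟩ }
  let ι := Quotient st
  let T : ι → ModuleCat.{u} Λ := fun j => fgModel (Quotient.out j).1
  have hT : ∀ j, P (T j) := fun j => (Quotient.out j).2.1
  have hTloc : ∀ j, IsLocalModule Λ (T j) := fun j => (Quotient.out j).2.2
  have hTfin : ∀ j, Module.Finite Λ (T j) := fun j => hP.finite _ (hT j)
  have hpi : LocallyFactors P (∀ j, T j) :=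
    hP.locallyFactors_pi fun j => LocallyFactors.of_prop (hT j)
  have hfin : Finite ι := by
    by_contra hinf
    rw [not_finite_iff_infinite] at hinf
    let φ : (DirectSum ι fun j => T j) →ₗ[Λ] (∀ j, T j) := sumToPi _
    have hφ : IsPureMap φ := isPureMap_sumToPi
    have hcomp : ∀ z k, φ z k = DirectSum.component Λ ι (fun j => T j) k z := fun _ _ => rfl
    let C := (∀ j, T j) ⧸ LinearMap.range φ
    have hC : Nontrivial C := by
      have : ∀ j, ∃ y : T j, y ≠ 0 := fun j => by
        have := (hTloc j).1
        exact exists_ne 0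
      choose y hy using this
      refine ⟨⟨(LinearMap.range φ).mkQ y, 0, fun h => ?_⟩⟩
      obtain ⟨z, hz⟩ := (Submodule.Quotient.mk_eq_zero _).1 h
      obtain ⟨j, hj⟩ := Infinite.exists_notMem_finset (DFinsupp.support z)
      rw [DFinsupp.notMem_support_iff] at hj
      exact hy j ((congrFun hz j).symm.trans hj)
    have hC' : Nontrivial (ModuleCat.of Λ C) := hC
    obtain ⟨N, s, r, _, hNloc, hrs⟩ := exists_isLocalModule_retract hP.finite
      (hc (ModuleCat.of Λ C) (hpi.quotient hφ))
    have := hNloc.1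
    obtain ⟨f, hf⟩ := hφ.exists_lift s
    -- The `T j` are pairwise non-isomorphic, so at most one coordinate is erased and the change
    -- lies in the direct sum. Afterwards no coordinate can split.
    let f' : ∀ j, N →ₗ[Λ] T j := fun j =>
      if Nonempty (N ≃ₗ[Λ] T j) then 0 else LinearMap.proj j ∘ₗ f
    have hf' : (LinearMap.range φ).mkQ ∘ₗ LinearMap.pi f' = s := by
      rw [← hf]
      ext x
      rw [LinearMap.comp_apply, LinearMap.comp_apply, ← sub_eq_zero, ← map_sub]
      refine (Submodule.Quotient.mk_eq_zero _).2 ?_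
      by_cases hj : ∃ j, Nonempty (N ≃ₗ[Λ] T j)
      · obtain ⟨j, ⟨e⟩⟩ := hj
        refine ⟨DirectSum.lof Λ ι (fun j => T j) j (-(f x j)), funext fun k => ?_⟩
        rw [hcomp, Pi.sub_apply, LinearMap.pi_apply, DirectSum.component.of]
        by_cases hk : j = k
        · subst hk
          have : f' j = 0 := if_pos ⟨e⟩
          rw [dif_pos rfl, this]
          simp
        · have : f' k = LinearMap.proj k ∘ₗ f := if_neg fun ⟨e'⟩ => hk (by
            rw [← Quotient.out_eq j, ← Quotient.out_eq k]
            exact Quotient.sound ⟨e.symm.trans e'⟩)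
          rw [dif_neg hk, this]
          simp
      · have : ∀ j, f' j = LinearMap.proj j ∘ₗ f := fun j => if_neg fun h => hj ⟨j, h⟩
        refine ⟨0, funext fun k => ?_⟩
        rw [map_zero, Pi.sub_apply, LinearMap.pi_apply, this]
        simp
    refine comp_pi_ne_id hNloc.2 f' (fun j g hg => ?_) (r ∘ₗ (LinearMap.range φ).mkQ) ?_
    · by_cases hj : Nonempty (N ≃ₗ[Λ] T j)
      · have : f' j = 0 := if_pos hj
        rw [this, LinearMap.comp_zero] at hg
        obtain ⟨x, hx⟩ := exists_ne (0 : N)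
        exact hx (LinearMap.congr_fun hg x).symm
      · exact hj ((hTloc j).exists_linearEquiv _ _ hg)
    · rw [LinearMap.comp_assoc, hf', hrs]
  let G := ModuleCat.of Λ (∀ j, T j)
  have : Fintype ι := Fintype.ofFinite ι
  have hGfin : Module.Finite Λ G := inferInstanceAs (Module.Finite Λ (∀ j, T j))
  refine ⟨G, hP.of_locallyFactors G hpi, fun Y hY => ?_⟩
  have := hP.finite Y hY
  obtain ⟨κ, _, W, s, r, hloc, hrs, hsum⟩ := exists_decomposition (Λ := Λ) Y
  have hW : ∀ l, ∃ j, Nonempty (W l ≃ₗ[Λ] T j) := by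
    intro l
    have hPW : P (W l) := hP.of_retract hY (W l) (s l) (r l) (hrs l)
    have := hP.finite _ hPW
    obtain ⟨x, ⟨e⟩⟩ := exists_fgModel (Λ := Λ) (W l)
    have hx : P (fgModel x) := hP.of_retract hPW (fgModel x) e.symm.toLinearMap e.toLinearMap
      (LinearMap.ext fun y => e.apply_symm_apply y)
    have hxloc : IsLocalModule Λ (fgModel x) := by
      have := (hloc l).1
      refine ⟨e.symm.toEquiv.nontrivial, fun z => ?_⟩
      let c := e.symm.conjRingEquiv
      rcases (hloc l).2 (c z) with h | h
      · left
        have := h.map c.symm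
        simpa using this
      · right
        have := h.map c.symm
        simpa using this
    refine ⟨Quotient.mk st ⟨x, hx, hxloc⟩, ?_⟩
    obtain ⟨e'⟩ : Nonempty (fgModel (Quotient.out (Quotient.mk st ⟨x, hx, hxloc⟩)).1 ≃ₗ[Λ]
      fgModel x) := Quotient.exact (Quotient.out_eq (Quotient.mk st ⟨x, hx, hxloc⟩))
    exact ⟨e.trans e'.symm⟩
  choose j e using hW
  let ε := Fintype.equivFin κ
  refine ⟨Fintype.card κ, LinearMap.pi fun k => LinearMap.single Λ (fun j => T j) (j (ε.symm k)) ∘ₗ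
    (e (ε.symm k)).some.toLinearMap ∘ₗ r (ε.symm k),
    ∑ l, s l ∘ₗ (e l).some.symm.toLinearMap ∘ₗ LinearMap.proj (j l) ∘ₗ LinearMap.proj (ε l), ?_⟩
  refine Eq.trans ?_ hsum
  ext y
  simp only [LinearMap.comp_apply, LinearMap.sum_apply]
  refine Finset.sum_congr rfl fun l _ => congrArg (s l) ?_
  have h1 : ∀ k, k = l → (e l).some.symm (LinearMap.single Λ (fun j => T j) (j k)
      ((e k).some (r k y)) (j l)) = r l y := by
    rintro k rfl
    simp
  exact h1 _ (ε.symm_apply_apply l)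

end FiniteType

end ClusterTilting

namespace ClusterTilting

/-! ### From an additive generator to direct sum decompositions. -/

section Generator

variable {Λ : Type u} [Ring Λ] {P : ObjectProperty (ModuleCat.{u} Λ)}

theorem isArtinianRing_end [IsArtinAlgebra Λ] (G : Type u) [AddCommGroup G] [Module Λ G]
    [Module.Finite Λ G] : IsArtinianRing (Module.End Λ G) := by
  obtain ⟨R, _, _, _, _⟩ := IsArtinAlgebra.exists_base (Λ := Λ)
  let : Module R G := Module.compHom G (algebraMap R Λ)
  have : IsScalarTower R Λ G := ⟨fun r a x => by rw [Algebra.smul_def, mul_smul]; rfl⟩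
  have : Module.Finite R G := Module.Finite.trans Λ G
  obtain ⟨m, p, hp⟩ := Module.Finite.exists_fin' Λ G
  let ev : Module.End Λ G →ₗ[R] (Fin m → G) :=
    { toFun := fun f i => f (p (Pi.single i 1))
      map_add' := fun _ _ => rfl
      map_smul' := fun _ _ => rfl }
  have hev : Function.Injective ev := by
    intro f g hfg
    have h1 : f ∘ₗ p = g ∘ₗ p := by
      refine LinearMap.pi_ext' fun i => LinearMap.ext_ring ?_
      exact congrFun hfg i
    ext x
    obtain ⟨y, rfl⟩ := hp x
    exact LinearMap.congr_fun h1 y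
  have : IsArtinian R (Module.End Λ G) := isArtinian_of_injective ev hev
  exact isArtinian_of_tower R this

/-- If all maps `G → X` factor through the radical of the endomorphism ring of `G`, then there are
none but zero. -/
theorem eq_zero_of_closure_jacobson_eq_top [IsArtinAlgebra Λ] {G X : Type u} [AddCommGroup G]
    [Module Λ G] [Module.Finite Λ G] [AddCommGroup X] [Module Λ X]
    (h : AddSubgroup.closure {f : G →ₗ[Λ] X | ∃ (b : G →ₗ[Λ] X) (c : Module.End Λ G),
      c ∈ Ideal.jacobson (⊥ : Ideal (Module.End Λ G)) ∧ f = b ∘ₗ c} = ⊤) (f : G →ₗ[Λ] X) :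
    f = 0 := by
  have := isArtinianRing_end (Λ := Λ) G
  obtain ⟨k, hk⟩ := IsArtinianRing.isNilpotent_jacobson_bot (R := Module.End Λ G)
  set J := Ideal.jacobson (⊥ : Ideal (Module.End Λ G))
  -- Nakayama for Hom(G, X), which need not be finitely generated: the hypothesis iterates to all
  -- powers of the radical, and the radical is nilpotent.
  have key : ∀ (l : ℕ) (f : G →ₗ[Λ] X), f ∈ AddSubgroup.closure {f : G →ₗ[Λ] X |
      ∃ (b : G →ₗ[Λ] X) (c : Module.End Λ G), c ∈ J ^ (l + 1) ∧ f = b ∘ₗ c} := by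
    intro l
    induction l with
    | zero => simp only [zero_add, Submodule.pow_one, h]; exact fun f => AddSubgroup.mem_top f
    | succ l ih =>
      intro f
      refine AddSubgroup.closure_induction (fun f hf => ?_) (zero_mem _)
        (fun _ _ _ _ => add_mem) (fun _ _ => neg_mem) (ih f)
      obtain ⟨b, c, hc, rfl⟩ := hf
      have hb : b ∈ AddSubgroup.closure {f : G →ₗ[Λ] X |
        ∃ (b : G →ₗ[Λ] X) (c : Module.End Λ G), c ∈ J ∧ f = b ∘ₗ c} := h ▸ AddSubgroup.mem_top b
      refine AddSubgroup.closure_induction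
        (p := fun b _ => b ∘ₗ c ∈ AddSubgroup.closure {f : G →ₗ[Λ] X |
          ∃ (b : G →ₗ[Λ] X) (c : Module.End Λ G), c ∈ J ^ (l + 1 + 1) ∧ f = b ∘ₗ c})
        (fun b hb => ?_) ?_ (fun b b' _ _ hb hb' => ?_) (fun b _ hb => ?_) hb
      · obtain ⟨b', c', hc', rfl⟩ := hb
        refine AddSubgroup.subset_closure ⟨b', c' * c, ?_, rfl⟩
        rw [Submodule.pow_succ' _ (Nat.succ_ne_zero l)]
        exact Ideal.mul_mem_mul hc' hc
      · rw [LinearMap.zero_comp]; exact zero_mem _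
      · rw [LinearMap.add_comp]; exact add_mem hb hb'
      · rw [LinearMap.neg_comp]; exact neg_mem hb
  refine AddSubgroup.closure_induction (p := fun f _ => f = 0) (fun f hf => ?_) rfl
    (fun _ _ _ _ h h' => by rw [h, h', add_zero]) (fun _ _ h => by rw [h, neg_zero]) (key k f)
  obtain ⟨b, c, hc, rfl⟩ := hf
  rw [Submodule.pow_succ, hk, zero_mul] at hc
  have : c = 0 := hc
  rw [this, LinearMap.comp_zero]

/-- A nonzero module locally factoring through `P` has a nonzero pure submodule in `P`, provided
that `P` has an additive generator. -/
theorem IsApproximating.exists_isPureMap [IsArtinAlgebra Λ] (hP : IsApproximating P)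
    {G : ModuleCat.{u} Λ} (hG : P G)
    (hgen : ∀ Y, P Y → ∃ (m : ℕ) (s : Y →ₗ[Λ] (Fin m → G)) (r : (Fin m → G) →ₗ[Λ] Y),
      r ∘ₗ s = LinearMap.id)
    {X : Type u} [AddCommGroup X] [Module Λ X] [Nontrivial X] (hX : LocallyFactors P X) :
    ∃ (Y : ModuleCat.{u} Λ) (h : Y →ₗ[Λ] X), P Y ∧ Nontrivial Y ∧ IsPureMap h := by
  have := IsArtinAlgebra.isArtinianRing Λ
  have := hP.finite G hG
  have hfac : ∀ (A : Type u) [AddCommGroup A] [Module Λ A] [Module.Finite Λ A] (f : A →ₗ[Λ] X),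
      ∃ (m : ℕ) (u : A →ₗ[Λ] (Fin m → G)) (v : (Fin m → G) →ₗ[Λ] X), v ∘ₗ u = f := by
    intro A _ _ _ f
    obtain ⟨Y, hY, g, h, rfl⟩ := hX A f
    obtain ⟨m, s, r, hrs⟩ := hgen Y hY
    refine ⟨m, s ∘ₗ g, h ∘ₗ r, ?_⟩
    rw [LinearMap.comp_assoc, ← LinearMap.comp_assoc g, hrs, LinearMap.id_comp]
  set J := Ideal.jacobson (⊥ : Ideal (Module.End Λ G)) with hJ
  set HJ := AddSubgroup.closure {f : G →ₗ[Λ] X | ∃ (b : G →ₗ[Λ] X) (c : Module.End Λ G),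
      c ∈ J ∧ f = b ∘ₗ c} with hHJ
  have hne : HJ ≠ ⊤ := by
    intro htop
    obtain ⟨x, hx⟩ := exists_ne (0 : X)
    obtain ⟨m, u, v, huv⟩ := hfac Λ (LinearMap.toSpanSingleton Λ X x)
    have hv : v = 0 := LinearMap.pi_ext' fun k =>
      (eq_zero_of_closure_jacobson_eq_top htop _).trans (LinearMap.zero_comp _).symm
    rw [hv, LinearMap.zero_comp] at huv
    have := LinearMap.congr_fun huv 1
    exact hx (by simpa using this.symm)
  obtain ⟨h₀, hh₀⟩ : ∃ h₀ : G →ₗ[Λ] X, h₀ ∉ HJ := by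
    by_contra hall
    push Not at hall
    exact hne (eq_top_iff.2 fun f _ => hall f)
  obtain ⟨κ, _, Y, s, r, hloc, hrs, hsum⟩ := exists_decomposition (Λ := Λ) G
  obtain ⟨i, hi⟩ : ∃ i, h₀ ∘ₗ s i ∘ₗ r i ∉ HJ := by
    by_contra hall
    push Not at hall
    refine hh₀ ?_
    have h1 : h₀ = ∑ i, h₀ ∘ₗ s i ∘ₗ r i := by
      conv_lhs => rw [← LinearMap.comp_id h₀, ← hsum]
      ext x
      simp
    rw [h1]
    exact sum_mem fun i _ => hall i
  refine ⟨Y i, h₀ ∘ₗ s i, hP.of_retract hG (Y i) (s i) (r i) (hrs i), (hloc i).1, ?_⟩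
  have hYfin : Module.Finite Λ (Y i) :=
    Module.Finite.of_surjective (r i) fun z => ⟨s i z, LinearMap.congr_fun (hrs i) z⟩
  intro L Z _ _ _ _ _ _ a j b hab
  -- The quotient by `S` is the pushout of `a` and `j`. Its map to `X` factors through a power of
  -- `G`, and it suffices that `Y i` splits off this power.
  let S : Submodule Λ (Y i × Z) := LinearMap.range (a.prod (-j))
  let f : (Y i × Z) ⧸ S →ₗ[Λ] X := S.liftQ ((h₀ ∘ₗ s i).coprod b) (by
    rintro _ ⟨l, rfl⟩
    have := LinearMap.congr_fun hab l
    simp only [LinearMap.comp_apply] at this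
    simp [this])
  obtain ⟨m, u, v, huv⟩ := hfac _ f
  let uY : Y i →ₗ[Λ] (Fin m → G) := u ∘ₗ S.mkQ ∘ₗ LinearMap.inl Λ _ _
  let uZ : Z →ₗ[Λ] (Fin m → G) := u ∘ₗ S.mkQ ∘ₗ LinearMap.inr Λ _ _
  have huY : v ∘ₗ uY = h₀ ∘ₗ s i := by
    ext y
    have := LinearMap.congr_fun huv (S.mkQ (y, 0))
    refine this.trans ?_
    change (h₀ ∘ₗ s i) y + b 0 = _
    rw [map_zero, add_zero]
  have huZ : uZ ∘ₗ j = uY ∘ₗ a := by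
    ext1 l
    have h1 : S.mkQ (0, j l) = S.mkQ (a l, 0) := by
      refine ((Submodule.Quotient.eq S).2 ⟨l, ?_⟩).symm
      simp
    exact congrArg u h1
  suffices hd : ∃ d : (Fin m → G) →ₗ[Λ] Y i, d ∘ₗ uY = LinearMap.id by
    obtain ⟨d, hd⟩ := hd
    refine ⟨d ∘ₗ uZ, ?_⟩
    rw [LinearMap.comp_assoc, huZ, ← LinearMap.comp_assoc, hd, LinearMap.id_comp]
  by_contra hno
  push Not at hno
  -- Otherwise locality of End(`Y i`) puts every coordinate of `uY` in the radical, and then `h₀ ∘ s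
  -- i ∘ r i` lies in `HJ`, against the choice of `i`.
  have hmem : ∀ k, (LinearMap.proj k ∘ₗ uY) ∘ₗ r i ∈ J := by
    intro k
    refine mem_jacobson_of_isNilpotent_mul fun γ => ?_
    let x : Module.End Λ (Y i) := r i ∘ₗ γ ∘ₗ LinearMap.proj k ∘ₗ uY
    rcases (hloc i).2 x with ⟨z, hz⟩ | ⟨l, hl⟩
    · refine absurd ?_ (hno (((z⁻¹ : (Module.End Λ (Y i))ˣ) : Module.End Λ (Y i)) ∘ₗ r i ∘ₗ γ ∘ₗ
        LinearMap.proj k))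
      have h3 : ((z⁻¹ : (Module.End Λ (Y i))ˣ) : Module.End Λ (Y i)) * x = 1 := by
        rw [← hz, Units.inv_mul]
      exact h3
    · refine ⟨l + 1, ?_⟩
      have h1 : ∀ l : ℕ, (γ * ((LinearMap.proj k ∘ₗ uY) ∘ₗ r i)) ^ (l + 1) =
          (γ ∘ₗ LinearMap.proj k ∘ₗ uY) ∘ₗ (x ^ l) ∘ₗ r i := by
        intro l
        induction l with
        | zero => rw [zero_add, pow_one]; rfl
        | succ l ih => rw [pow_succ', ih, pow_succ']; rfl
      rw [h1, hl, LinearMap.zero_comp, LinearMap.comp_zero]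
  refine hi ?_
  have h1 : h₀ ∘ₗ s i ∘ₗ r i = ∑ k, (v ∘ₗ LinearMap.single Λ (fun _ => (G : Type u)) k) ∘ₗ
      ((LinearMap.proj k ∘ₗ uY) ∘ₗ r i) := by
    rw [← LinearMap.comp_assoc, ← huY]
    ext g
    simp only [LinearMap.comp_apply, LinearMap.sum_apply, LinearMap.proj_apply]
    rw [← map_sum]
    exact congrArg v (LinearMap.sum_single_apply (fun _ : Fin m => (G : Type u)) _).symm
  rw [h1]
  exact sum_mem fun k _ => AddSubgroup.subset_closure ⟨_, _, hmem k, rfl⟩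

/-- The elements of a direct sum that are supported in `T`. -/
def supportedIn {ι : Type u} (Y : ι → Type u) [∀ k, AddCommGroup (Y k)] [∀ k, Module Λ (Y k)]
    (T : Set ι) : Submodule Λ (DirectSum ι Y) where
  carrier := {d | ∀ k, k ∉ T → d k = 0}
  add_mem' := fun {a b} ha hb k hk => by
    rw [DirectSum.add_apply, ha k hk, hb k hk, add_zero]
  zero_mem' := fun k _ => rfl
  smul_mem' := fun c d hd k hk => by
    rw [DirectSum.smul_apply, hd k hk, smul_zero]

theorem isPureMap_sUnion {ι : Type u} {Y : ι → Type u} [∀ k, AddCommGroup (Y k)]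
    [∀ k, Module Λ (Y k)] {X : Type u} [AddCommGroup X] [Module Λ X] (φ : DirectSum ι Y →ₗ[Λ] X)
    {c : Set (Set ι)} (hc : IsChain (· ⊆ ·) c) (hne : c.Nonempty)
    (h : ∀ T ∈ c, IsPureMap (φ ∘ₗ (supportedIn (Λ := Λ) Y T).subtype)) :
    IsPureMap (φ ∘ₗ (supportedIn (Λ := Λ) Y (⋃₀ c)).subtype) := by
  classical
  intro L Z _ _ _ _ _ _ a j b hab
  obtain ⟨F, hF⟩ := exists_finset_comp_eq ((supportedIn (Λ := Λ) Y (⋃₀ c)).subtype ∘ₗ a)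
  have hex : ∃ T ∈ c, ∀ k ∈ F, k ∈ ⋃₀ c → k ∈ T := by
    clear hF
    induction F using Finset.induction_on with
    | empty =>
      obtain ⟨T, hT⟩ := hne
      exact ⟨T, hT, by simp⟩
    | insert k F _ ih =>
      obtain ⟨T, hT, hTF⟩ := ih
      by_cases hk : k ∈ ⋃₀ c
      · obtain ⟨T', hT', hkT'⟩ := hk
        obtain ⟨U, hU, h1, h2⟩ := hc.directedOn T hT T' hT'
        refine ⟨U, hU, fun l hl hlc => ?_⟩
        rcases Finset.mem_insert.1 hl with rfl | hl
        · exact h2 hkT'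
        · exact h1 (hTF l hl hlc)
      · refine ⟨T, hT, fun l hl hlc => ?_⟩
        rcases Finset.mem_insert.1 hl with rfl | hl
        · exact absurd hlc hk
        · exact hTF l hl hlc
  obtain ⟨T, hT, hTF⟩ := hex
  have hsub : supportedIn (Λ := Λ) Y T ≤ supportedIn (Λ := Λ) Y (⋃₀ c) :=
    fun d hd k hk => hd k fun hkT => hk ⟨T, hT, hkT⟩
  have haT : ∀ l, (a l : DirectSum ι Y) ∈ supportedIn (Λ := Λ) Y T := by
    intro l k hk
    by_cases hkc : k ∈ ⋃₀ c
    · have h1 : finsetIncl (Λ := Λ) Y F (finsetProj (Λ := Λ) Y F (a l)) = a l :=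
        LinearMap.congr_fun hF l
      rw [← h1, finsetIncl_apply, dif_neg fun hkF => hk (hTF k hkF hkc)]
    · exact (a l).2 k hkc
  obtain ⟨d, hd⟩ := h T hT L Z
    (((supportedIn (Λ := Λ) Y (⋃₀ c)).subtype ∘ₗ a).codRestrict _ haT) j b
    (hab.trans (LinearMap.ext fun l => rfl))
  refine ⟨Submodule.inclusion hsub ∘ₗ d, LinearMap.ext fun l => Subtype.ext ?_⟩
  have h1 := LinearMap.congr_fun hd l
  exact (Subtype.ext_iff.1 h1 :)

/-- If `P` has an additive generator, every module locally factoring through `P` is a direct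
summand of a direct sum of modules in `P`. -/
theorem IsApproximating.addClosure_of_generator [IsArtinAlgebra Λ] (hP : IsApproximating P)
    {G : ModuleCat.{u} Λ} (hG : P G)
    (hgen : ∀ Y, P Y → ∃ (m : ℕ) (s : Y →ₗ[Λ] (Fin m → G)) (r : (Fin m → G) →ₗ[Λ] Y),
      r ∘ₗ s = LinearMap.id)
    {X : ModuleCat.{u} Λ} (hX : LocallyFactors P X) : AddClosure P X := by
  classical
  let K := Σ x : {x : Σ m : ℕ, Submodule Λ (Fin m → Λ) // P (fgModel x)}, (fgModel x.1 →ₗ[Λ] X)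
  let W : K → ModuleCat.{u} Λ := fun k => fgModel k.1.1
  let Y : K → Type u := fun k => W k
  let φ : DirectSum K Y →ₗ[Λ] X := DirectSum.toModule Λ K X fun k => k.2
  let Q : Set K → Submodule Λ (DirectSum K Y) := supportedIn Y
  have hφ : ∀ k (y : Y k), φ (DirectSum.lof Λ K Y k y) = k.2 y :=
    fun k y => DirectSum.toModule_lof Λ k y
  -- `K` lists all maps to `X` from small models of modules in `P`; a pure direct sum inside `X` is
  -- a subset of `K`.
  obtain ⟨T, -, hT⟩ := zorn_subset_nonempty {T : Set K | IsPureMap (φ ∘ₗ (Q T).subtype)}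
    (fun c hc hchain hne => ⟨⋃₀ c, isPureMap_sUnion φ hchain hne hc,
      fun s hs => Set.subset_sUnion_of_mem hs⟩) ∅ (by
      intro L Z _ _ _ _ _ _ a j b _
      refine ⟨0, LinearMap.ext fun l => Subtype.ext (DFinsupp.ext fun k => ?_)⟩
      exact ((a l).2 k (Set.notMem_empty k)).symm)
  have hTp : IsPureMap (φ ∘ₗ (Q T).subtype) := hT.prop
  have hrange : LinearMap.range (φ ∘ₗ (Q T).subtype) = ⊤ := by
    by_contra hne
    have hnt : Nontrivial (X ⧸ LinearMap.range (φ ∘ₗ (Q T).subtype)) :=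
      Submodule.Quotient.nontrivial_iff.2 hne
    obtain ⟨V, h', hV, hVnt, hpure'⟩ := hP.exists_isPureMap hG hgen (hX.quotient hTp)
    have := hP.finite V hV
    obtain ⟨x, ⟨e⟩⟩ := exists_fgModel (Λ := Λ) V
    have hx : P (fgModel x) := hP.of_retract hV (fgModel x) e.symm.toLinearMap e.toLinearMap
      (LinearMap.ext fun y => e.apply_symm_apply y)
    have := hP.finite _ hx
    have hpure : IsPureMap (h' ∘ₗ e.symm.toLinearMap) := by
      intro L Z _ _ _ _ _ _ a j b hab
      obtain ⟨c, hc⟩ := hpure' L Z (e.symm.toLinearMap ∘ₗ a) j b hab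
      refine ⟨e.toLinearMap ∘ₗ c, ?_⟩
      rw [LinearMap.comp_assoc, hc]
      ext l
      simp
    obtain ⟨h, hh⟩ := hTp.exists_lift (h' ∘ₗ e.symm.toLinearMap)
    let k₀ : K := ⟨⟨x, hx⟩, h⟩
    have hdec : ∀ d ∈ Q (insert k₀ T), d - DirectSum.lof Λ K Y k₀ (d k₀) ∈ Q T := by
      intro d hd k hk
      rw [DirectSum.apply_eq_component Λ, map_sub, DirectSum.component.of]
      by_cases hkk : k₀ = k
      · subst hkk
        rw [dif_pos rfl]
        exact sub_self _
      · rw [dif_neg hkk, sub_zero]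
        exact hd k fun h => (Set.mem_insert_iff.1 h).elim (fun h => hkk h.symm) hk
    have hle : Q T ≤ Q (insert k₀ T) := fun d hd k hk => hd k fun h => hk (Set.mem_insert_of_mem _ h)
    have hlof : ∀ y, DirectSum.lof Λ K Y k₀ y ∈ Q (insert k₀ T) := by
      intro y k hk
      rw [DirectSum.apply_eq_component Λ, DirectSum.component.of, dif_neg]
      rintro rfl
      exact hk (Set.mem_insert _ _)
    -- Solve first for the new coordinate modulo the image of the old sum, then correct within the
    -- old sum.
    have hins : IsPureMap (φ ∘ₗ (Q (insert k₀ T)).subtype) := by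
      intro L Z _ _ _ _ _ _ a j b hab
      let a₂ : L →ₗ[Λ] Y k₀ :=
        DirectSum.component Λ K Y k₀ ∘ₗ (Q (insert k₀ T)).subtype ∘ₗ a
      let a₁ : L →ₗ[Λ] Q T := ((Q (insert k₀ T)).subtype ∘ₗ a -
        DirectSum.lof Λ K Y k₀ ∘ₗ a₂).codRestrict _ fun l => hdec _ (a l).2
      have ha : ∀ l, φ (a l) = φ (a₁ l) + h (a₂ l) := by
        intro l
        have h1 : ((a₁ l : Q T) : DirectSum K Y) = a l - DirectSum.lof Λ K Y k₀ (a₂ l) := rfl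
        rw [h1, map_sub, hφ]
        exact (sub_add_cancel _ _).symm
      have hab' : ∀ l, b (j l) = φ (a l) := LinearMap.congr_fun hab
      obtain ⟨c₂, hc₂⟩ := hpure L Z a₂ j
        ((LinearMap.range (φ ∘ₗ (Q T).subtype)).mkQ ∘ₗ b) (by
          rw [← hh]
          ext l
          simp only [LinearMap.comp_apply]
          rw [hab', ha, map_add, add_eq_right]
          exact (Submodule.Quotient.mk_eq_zero _).2 ⟨a₁ l, rfl⟩)
      obtain ⟨c₁, hc₁⟩ := hTp L Z a₁ j (b - h ∘ₗ c₂) (by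
        ext l
        have h2 : c₂ (j l) = a₂ l := LinearMap.congr_fun hc₂ l
        simp only [LinearMap.comp_apply, LinearMap.sub_apply]
        rw [hab', ha, h2, add_sub_cancel_right]
        rfl)
      refine ⟨Submodule.inclusion hle ∘ₗ c₁ +
        (DirectSum.lof Λ K Y k₀ ∘ₗ c₂).codRestrict _ fun z => hlof _, ?_⟩
      ext1 l
      refine Subtype.ext ?_
      have h2 : c₂ (j l) = a₂ l := LinearMap.congr_fun hc₂ l
      have h3 : c₁ (j l) = a₁ l := LinearMap.congr_fun hc₁ l
      change ((c₁ (j l) : Q T) : DirectSum K Y) + DirectSum.lof Λ K Y k₀ (c₂ (j l)) = a l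
      rw [h2, h3]
      exact sub_add_cancel _ _
    have hk₀ : k₀ ∈ T := hT.le_of_ge hins (Set.subset_insert _ _) (Set.mem_insert _ _)
    have hnt' : Nontrivial (fgModel x) := e.symm.toEquiv.nontrivial
    obtain ⟨y, hy⟩ := exists_ne (0 : fgModel x)
    refine hy (hpure.injective ?_)
    rw [map_zero, ← hh]
    refine (Submodule.Quotient.mk_eq_zero _).2 ⟨⟨DirectSum.lof Λ K Y k₀ y, fun k hk => ?_⟩, hφ k₀ y⟩
    rw [DirectSum.apply_eq_component Λ, DirectSum.component.of, dif_neg]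
    rintro rfl
    exact hk hk₀
  let ε := LinearEquiv.ofBijective (φ ∘ₗ (Q T).subtype)
    ⟨hTp.injective, LinearMap.range_eq_top.1 hrange⟩
  refine ⟨K, W, fun k => k.1.2, ⟨⟨ModuleCat.ofHom ((Q T).subtype ∘ₗ ε.symm.toLinearMap),
    ModuleCat.ofHom φ, ?_⟩⟩⟩
  ext z
  exact ε.apply_symm_apply z

end Generator

end ClusterTilting

namespace ClusterTilting

/-! ### Vanishing of Ext along retracts and short exact sequences. -/

section ExtVanishing

variable {C : Type u} [Category.{v} C] [Abelian C] [HasExt.{w} C]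

open Abelian

theorem subsingleton_ext_of_retract_left {A B : C} (ρ : Retract A B) (Y : C) (i : ℕ)
    (h : Subsingleton (Ext.{w} B Y i)) : Subsingleton (Ext.{w} A Y i) := by
  refine subsingleton_of_forall_eq 0 fun x => ?_
  have h1 : (Ext.mk₀ ρ.r).comp x (zero_add i) = 0 := Subsingleton.elim _ _
  have h2 : (Ext.mk₀ ρ.i).comp ((Ext.mk₀ ρ.r).comp x (zero_add i)) (zero_add i) = x := by
    rw [← Ext.comp_assoc_of_second_deg_zero, Ext.mk₀_comp_mk₀, ρ.retract, Ext.mk₀_id_comp]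
  rw [← h2, h1, Ext.comp_zero]

theorem subsingleton_ext_of_retract_right {A B : C} (ρ : Retract A B) (X : C) (i : ℕ)
    (h : Subsingleton (Ext.{w} X B i)) : Subsingleton (Ext.{w} X A i) := by
  refine subsingleton_of_forall_eq 0 fun x => ?_
  have h1 : x.comp (Ext.mk₀ ρ.i) (add_zero i) = 0 := Subsingleton.elim _ _
  have h2 : (x.comp (Ext.mk₀ ρ.i) (add_zero i)).comp (Ext.mk₀ ρ.r) (add_zero i) = x := by
    rw [Ext.comp_assoc_of_second_deg_zero, Ext.mk₀_comp_mk₀, ρ.retract, Ext.comp_mk₀_id]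
  rw [← h2, h1, Ext.zero_comp]

variable {S : ShortComplex C}

theorem _root_.CategoryTheory.ShortComplex.ShortExact.subsingleton_ext_X₁_left
    (hS : S.ShortExact) {Y : C} {i : ℕ} (h₂ : Subsingleton (Ext.{w} S.X₂ Y i))
    (h₃ : Subsingleton (Ext.{w} S.X₃ Y (i + 1))) : Subsingleton (Ext.{w} S.X₁ Y i) := by
  refine subsingleton_of_forall_eq 0 fun x => ?_
  obtain ⟨y, rfl⟩ := Ext.contravariant_sequence_exact₁ hS Y x (add_comm 1 i) (Subsingleton.elim _ _)
  rw [Subsingleton.elim y 0, Ext.comp_zero]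

theorem _root_.CategoryTheory.ShortComplex.ShortExact.subsingleton_ext_X₃_left
    (hS : S.ShortExact) {Y : C} {i : ℕ} (h₁ : Subsingleton (Ext.{w} S.X₁ Y i))
    (h₂ : Subsingleton (Ext.{w} S.X₂ Y (i + 1))) : Subsingleton (Ext.{w} S.X₃ Y (i + 1)) := by
  refine subsingleton_of_forall_eq 0 fun x => ?_
  obtain ⟨y, rfl⟩ := Ext.contravariant_sequence_exact₃ hS Y x (Subsingleton.elim _ _) (add_comm 1 i)
  rw [Subsingleton.elim y 0, Ext.comp_zero]

theorem _root_.CategoryTheory.ShortComplex.ShortExact.subsingleton_ext_one_X₃_left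
    (hS : S.ShortExact) {Y : C} (h₁ : ∀ f : S.X₁ ⟶ Y, ∃ g : S.X₂ ⟶ Y, S.f ≫ g = f)
    (h₂ : Subsingleton (Ext.{w} S.X₂ Y 1)) : Subsingleton (Ext.{w} S.X₃ Y 1) := by
  refine subsingleton_of_forall_eq 0 fun x => ?_
  obtain ⟨y, rfl⟩ := Ext.contravariant_sequence_exact₃ hS Y x (Subsingleton.elim _ _) (add_zero 1)
  obtain ⟨f, rfl⟩ := Ext.addEquiv₀.symm.surjective y
  obtain ⟨g, rfl⟩ := h₁ f
  change hS.extClass.comp (Ext.mk₀ (S.f ≫ g)) _ = 0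
  rw [← Ext.mk₀_comp_mk₀]
  exact (Ext.comp_assoc_of_second_deg_zero _ _ _ _).symm.trans
    (by rw [hS.extClass_comp, Ext.zero_comp])

theorem _root_.CategoryTheory.ShortComplex.ShortExact.exists_extension
    (hS : S.ShortExact) {Y : C} (h₃ : Subsingleton (Ext.{w} S.X₃ Y 1)) (f : S.X₁ ⟶ Y) :
    ∃ g : S.X₂ ⟶ Y, S.f ≫ g = f := by
  obtain ⟨y, hy⟩ := Ext.contravariant_sequence_exact₁ hS Y (Ext.mk₀ f) (add_zero 1)
    (Subsingleton.elim _ _)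
  obtain ⟨g, rfl⟩ := Ext.addEquiv₀.symm.surjective y
  refine ⟨g, Ext.addEquiv₀.symm.injective ?_⟩
  change Ext.mk₀ _ = Ext.mk₀ _
  rw [← hy, ← Ext.mk₀_comp_mk₀]
  rfl

theorem _root_.CategoryTheory.ShortComplex.ShortExact.subsingleton_ext_X₃_right
    (hS : S.ShortExact) {X : C} {i : ℕ} (h₂ : Subsingleton (Ext.{w} X S.X₂ i))
    (h₁ : Subsingleton (Ext.{w} X S.X₁ (i + 1))) : Subsingleton (Ext.{w} X S.X₃ i) := by
  refine subsingleton_of_forall_eq 0 fun x => ?_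
  obtain ⟨y, rfl⟩ := Ext.covariant_sequence_exact₃ X hS x rfl (Subsingleton.elim _ _)
  rw [Subsingleton.elim y 0, Ext.zero_comp]

theorem _root_.CategoryTheory.ShortComplex.ShortExact.subsingleton_ext_X₁_right
    (hS : S.ShortExact) {X : C} {i : ℕ} (h₃ : Subsingleton (Ext.{w} X S.X₃ i))
    (h₂ : Subsingleton (Ext.{w} X S.X₂ (i + 1))) : Subsingleton (Ext.{w} X S.X₁ (i + 1)) := by
  refine subsingleton_of_forall_eq 0 fun x => ?_
  obtain ⟨y, rfl⟩ := Ext.covariant_sequence_exact₁ X hS x (Subsingleton.elim _ _) rfl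
  rw [Subsingleton.elim y 0, Ext.zero_comp]

theorem _root_.CategoryTheory.ShortComplex.ShortExact.subsingleton_ext_one_X₁_right
    (hS : S.ShortExact) {X : C} (h₃ : ∀ f : X ⟶ S.X₃, ∃ g : X ⟶ S.X₂, g ≫ S.g = f)
    (h₂ : Subsingleton (Ext.{w} X S.X₂ 1)) : Subsingleton (Ext.{w} X S.X₁ 1) := by
  refine subsingleton_of_forall_eq 0 fun x => ?_
  obtain ⟨y, rfl⟩ := Ext.covariant_sequence_exact₁ X hS x (Subsingleton.elim _ _) (zero_add 1)
  obtain ⟨f, rfl⟩ := Ext.addEquiv₀.symm.surjective y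
  obtain ⟨g, rfl⟩ := h₃ f
  change (Ext.mk₀ (g ≫ S.g)).comp hS.extClass _ = 0
  rw [← Ext.mk₀_comp_mk₀]
  exact (Ext.comp_assoc_of_second_deg_zero _ _ _ _).trans
    (by rw [hS.comp_extClass, Ext.comp_zero])

theorem _root_.CategoryTheory.ShortComplex.ShortExact.exists_lift
    (hS : S.ShortExact) {X : C} (h₁ : Subsingleton (Ext.{w} X S.X₁ 1)) (f : X ⟶ S.X₃) :
    ∃ g : X ⟶ S.X₂, g ≫ S.g = f := by
  obtain ⟨y, hy⟩ := Ext.covariant_sequence_exact₃ X hS (Ext.mk₀ f) (zero_add 1)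
    (Subsingleton.elim _ _)
  obtain ⟨g, rfl⟩ := Ext.addEquiv₀.symm.surjective y
  refine ⟨g, Ext.addEquiv₀.symm.injective ?_⟩
  change Ext.mk₀ _ = Ext.mk₀ _
  rw [← hy, ← Ext.mk₀_comp_mk₀]
  rfl

end ExtVanishing

/-! ### Ext of finitely generated modules compared with Ext of all modules. -/

section Modules

variable {Λ : Type u} [Ring Λ]

open Abelian

theorem shortExact_of_exact {A B D : Type u} [AddCommGroup A] [Module Λ A] [AddCommGroup B]
    [Module Λ B] [AddCommGroup D] [Module Λ D] (f : A →ₗ[Λ] B) (g : B →ₗ[Λ] D)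
    (hf : Function.Injective f) (hg : Function.Surjective g) (h : Function.Exact f g) :
    (ShortComplex.mk (ModuleCat.ofHom f) (ModuleCat.ofHom g)
      (by ext x; exact h.apply_apply_eq_zero x)).ShortExact where
  exact := (ShortComplex.moduleCat_exact_iff _).2 fun x hx => (h x).1 hx
  mono_f := (ModuleCat.mono_iff_injective _).2 hf
  epi_g := (ModuleCat.epi_iff_surjective _).2 hg

theorem shortExact_ker {B D : Type u} [AddCommGroup B]
    [Module Λ B] [AddCommGroup D] [Module Λ D] (g : B →ₗ[Λ] D) (hg : Function.Surjective g) :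
    (ShortComplex.mk (ModuleCat.ofHom (LinearMap.ker g).subtype) (ModuleCat.ofHom g)
      (by ext x; exact x.2)).ShortExact :=
  shortExact_of_exact _ g (Submodule.injective_subtype _) hg (LinearMap.exact_subtype_ker_map g)

theorem shortExact_range {A B : Type u} [AddCommGroup A]
    [Module Λ A] [AddCommGroup B] [Module Λ B] (f : A →ₗ[Λ] B) (hf : Function.Injective f) :
    (ShortComplex.mk (ModuleCat.ofHom f) (ModuleCat.ofHom (LinearMap.range f).mkQ)
      (by ext x; exact (Submodule.Quotient.mk_eq_zero _).2 ⟨x, rfl⟩)).ShortExact :=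
  shortExact_of_exact f _ hf (Submodule.mkQ_surjective _) (LinearMap.exact_map_mkQ_range f)

theorem projective_of_projective_fg {X : FGModuleCat.{u} Λ} (hX : Projective X) :
    Projective X.obj := by
  obtain ⟨m, p, hp⟩ := Module.Finite.exists_fin' Λ X
  let p' : FGModuleCat.of Λ (Fin m → Λ) ⟶ X := FGModuleCat.ofHom p
  have : Epi p' := by
    refine ⟨fun {Z} a b hab => FGModuleCat.hom_ext (LinearMap.ext fun x => ?_)⟩
    obtain ⟨y, rfl⟩ := hp x
    exact congrArg (fun t => t.hom.hom y) hab
  obtain ⟨s, hs⟩ := Projective.factors (𝟙 X) p'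
  have h1 : Module.Projective Λ X := Module.Projective.of_split s.hom.hom p
    (congrArg (fun t => t.hom.hom) hs)
  exact (IsProjective.iff_projective (R := Λ) X.obj).1 h1

variable [IsNoetherianRing Λ]

theorem injective_of_mono_fg {A B : FGModuleCat.{u} Λ} (f : A ⟶ B) [Mono f] :
    Function.Injective f.hom.hom := by
  have : Mono ((forget₂ (FGModuleCat.{u} Λ) (ModuleCat.{u} Λ)).map f) := inferInstance
  exact (ModuleCat.mono_iff_injective _).1 this

/-- The embedding into all modules preserves projectives, so it is bijective on Ext. -/
theorem subsingleton_ext_fg_iff (X Y : FGModuleCat.{u} Λ) (i : ℕ) :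
    Subsingleton (Ext.{u} X Y i) ↔ Subsingleton (Ext.{u} X.obj Y.obj i) := by
  let F := forget₂ (FGModuleCat.{u} Λ) (ModuleCat.{u} Λ)
  have : F.Additive := inferInstanceAs ((ModuleCat.isFG.{u} Λ).ι.Additive)
  have : F.PreservesProjectiveObjects := ⟨projective_of_projective_fg⟩
  exact (Equiv.ofBijective _
    (F.mapExt_bijective_of_preservesProjectiveObjects X Y i)).subsingleton_congr

end Modules

/-! ### The perpendicular class of `M` among all modules. -/

section ToMod

variable {Λ : Type u} [Ring Λ]

open Abelian

theorem toMod_finite {M : ObjectProperty (FGModuleCat.{u} Λ)} {Y : ModuleCat.{u} Λ}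
    (hY : toMod M Y) : Module.Finite Λ Y := by
  obtain ⟨Z, -, ⟨e⟩⟩ := hY
  have : Module.Finite Λ ((ModuleCat.isFG.{u} Λ).ι.obj Z) := Z.property
  exact Module.Finite.equiv e.toLinearEquiv

theorem toMod_obj {M : ObjectProperty (FGModuleCat.{u} Λ)} {Y : FGModuleCat.{u} Λ}
    (hY : M Y) : toMod M Y.obj :=
  ⟨Y, hY, ⟨Iso.refl _⟩⟩

/-- An isomorphism exhibits its source as a retract of its target. -/
def retractOfIso {C : Type u} [Category.{v} C] {A B : C} (e : A ≅ B) : Retract A B :=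
  ⟨e.hom, e.inv, e.hom_inv_id⟩

variable [IsNoetherianRing Λ] {n : ℕ} {M : ObjectProperty (FGModuleCat.{u} Λ)}

theorem IsClusterTilting.subsingleton_ext (hM : IsClusterTilting.{u} n M) {X Y : ModuleCat.{u} Λ}
    (hX : toMod M X) (hY : toMod M Y) {i : ℕ} (hi : 0 < i) (hin : i < n) :
    Subsingleton (Ext.{u} X Y i) := by
  obtain ⟨X', hX', ⟨e⟩⟩ := hX
  obtain ⟨Y', hY', ⟨e'⟩⟩ := hY
  have h : rightPerp.{u} n M Y' := by rwa [hM.rightPerp_eq]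
  exact subsingleton_ext_of_retract_left (retractOfIso e.symm) _ _
    (subsingleton_ext_of_retract_right (retractOfIso e'.symm) _ _
      ((subsingleton_ext_fg_iff _ _ _).1 (h X' hX' i hi hin)))

theorem IsClusterTilting.toMod_of_leftPerp (hM : IsClusterTilting.{u} n M) {A : ModuleCat.{u} Λ}
    [Module.Finite Λ A] (h : ∀ Y, toMod M Y → ∀ i, 0 < i → i < n → Subsingleton (Ext.{u} A Y i)) :
    toMod M A := by
  refine toMod_obj (Y := ⟨A, ‹_›⟩) ?_
  rw [← hM.leftPerp_eq]
  exact fun Y hY i hi hin => (subsingleton_ext_fg_iff _ _ _).2 (h _ (toMod_obj hY) i hi hin)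

theorem IsClusterTilting.toMod_of_rightPerp (hM : IsClusterTilting.{u} n M) {A : ModuleCat.{u} Λ}
    [Module.Finite Λ A] (h : rightPerp.{u} n (toMod M) A) : toMod M A := by
  refine toMod_obj (Y := ⟨A, ‹_›⟩) ?_
  rw [← hM.rightPerp_eq]
  exact fun Y hY i hi hin => (subsingleton_ext_fg_iff _ _ _).2 (h _ (toMod_obj hY) i hi hin)

/-- The approximation is injective because an embedding into an object of `M` factors through it. -/
theorem IsClusterTilting.exists_approximation (hM : IsClusterTilting.{u} n M)
    (A : Type u) [AddCommGroup A] [Module Λ A] [Module.Finite Λ A] :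
    ∃ (Y : ModuleCat.{u} Λ) (θ : A →ₗ[Λ] Y), toMod M Y ∧ Function.Injective θ ∧
      ∀ Z : ModuleCat.{u} Λ, toMod M Z → ∀ f : A →ₗ[Λ] Z, ∃ g : Y →ₗ[Λ] Z, g ∘ₗ θ = f := by
  obtain ⟨Y, θ, hY, hθ⟩ := hM.covariantlyFinite (FGModuleCat.of Λ A)
  obtain ⟨B, β, hB, _⟩ := hM.cogenerating (FGModuleCat.of Λ A)
  refine ⟨Y.obj, θ.hom.hom, toMod_obj hY, ?_, ?_⟩
  · obtain ⟨g, hg⟩ := hθ B β hB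
    have h1 := injective_of_mono_fg β
    rw [← hg] at h1
    exact Function.Injective.of_comp h1
  · rintro Z ⟨Z', hZ', ⟨e⟩⟩ f
    obtain ⟨g, hg⟩ := hθ Z' ⟨ModuleCat.ofHom f ≫ e.inv⟩ hZ'
    refine ⟨e.hom.hom ∘ₗ g.hom.hom, ?_⟩
    have h1 : g.hom.hom ∘ₗ θ.hom.hom = e.inv.hom ∘ₗ f := congrArg (fun t => t.hom.hom) hg
    rw [LinearMap.comp_assoc, h1, ← LinearMap.comp_assoc, ← ModuleCat.hom_comp, e.inv_hom_id]
    rfl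

/-- Modules right perpendicular to `M` locally factor through `M`. -/
theorem IsClusterTilting.locallyFactors_of_rightPerp (hM : IsClusterTilting.{u} n M) (hn : 2 ≤ n)
    {X : ModuleCat.{u} Λ} (hX : rightPerp.{u} n (toMod M) X) : LocallyFactors (toMod M) X := by
  -- Passing to the cokernel of an approximation gains one degree of vanishing against `M`. Here `d`
  -- counts the passages left: at `d = 0` all degrees below `n` vanish, so `D` lies in `M`.
  have key : ∀ d k : ℕ, k + 1 + d + 1 = n → ∀ (D : ModuleCat.{u} Λ) [Module.Finite Λ D],
      (∀ Y, toMod M Y → ∀ i, 0 < i → i ≤ k + 1 → Subsingleton (Ext.{u} D Y i)) →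
      Subsingleton (Ext.{u} D X (k + 1)) := by
    intro d
    induction d with
    | zero =>
      intro k hk D _ hD
      exact hX D (hM.toMod_of_leftPerp fun Y hY i hi hin => hD Y hY i hi (by lia)) _ (by lia)
        (by lia)
    | succ d ih =>
      intro k hk D _ hD
      obtain ⟨Y, θ, hY, hinj, hθ⟩ := hM.exists_approximation D
      have := toMod_finite hY
      have hS := shortExact_range θ hinj
      refine hS.subsingleton_ext_X₁_left (hX Y hY _ (by lia) (by lia)) ?_
      have hfin : Module.Finite Λ (ModuleCat.of Λ (Y ⧸ LinearMap.range θ)) :=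
        inferInstanceAs (Module.Finite Λ (Y ⧸ LinearMap.range θ))
      refine ih (k + 1) (by lia) _ fun Z hZ i hi hik => ?_
      obtain ⟨i, rfl⟩ := Nat.exists_eq_succ_of_ne_zero hi.ne'
      rcases Nat.eq_zero_or_pos i with rfl | hi0
      · refine hS.subsingleton_ext_one_X₃_left (fun f => ?_)
          (hM.subsingleton_ext hY hZ (by lia) (by lia))
        obtain ⟨g, hg⟩ := hθ Z hZ f.hom
        exact ⟨ModuleCat.ofHom g, ModuleCat.hom_ext hg⟩
      · exact hS.subsingleton_ext_X₃_left (hD Z hZ i hi0 (by lia))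
          (hM.subsingleton_ext hY hZ (by lia) (by lia))
  intro A _ _ _ f
  obtain ⟨Y, θ, hY, hinj, hθ⟩ := hM.exists_approximation A
  have := toMod_finite hY
  have hS := shortExact_range θ hinj
  have hfin : Module.Finite Λ (ModuleCat.of Λ (Y ⧸ LinearMap.range θ)) :=
    inferInstanceAs (Module.Finite Λ (Y ⧸ LinearMap.range θ))
  obtain ⟨g, hg⟩ := hS.exists_extension (key (n - 2) 0 (by lia) _ fun Z hZ i hi hi1 => by
    obtain rfl : i = 1 := by lia
    refine hS.subsingleton_ext_one_X₃_left (fun f => ?_)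
      (hM.subsingleton_ext hY hZ (by lia) (by lia))
    obtain ⟨g, hg⟩ := hθ Z hZ f.hom
    exact ⟨ModuleCat.ofHom g, ModuleCat.hom_ext hg⟩) (ModuleCat.ofHom f)
  exact ⟨Y, hY, θ, g.hom, congrArg ModuleCat.Hom.hom hg⟩

/-- In degree one, a map from the finitely generated syzygy to `X` factors through `P`, where it
extends. Higher degrees shift to syzygies. -/
theorem subsingleton_ext_of_locallyFactors {P : ObjectProperty (ModuleCat.{u} Λ)}
    {X : ModuleCat.{u} Λ} (hX : LocallyFactors P X) (i : ℕ) :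
    ∀ (A : ModuleCat.{u} Λ) [Module.Finite Λ A],
      (∀ Y, P Y → Subsingleton (Ext.{u} A Y (i + 1))) → Subsingleton (Ext.{u} A X (i + 1)) := by
  induction i with
  | zero =>
    intro A _ hA
    obtain ⟨m, p, hp⟩ := Module.Finite.exists_fin' Λ A
    have hS := shortExact_ker p hp
    have hproj : Projective (ModuleCat.of Λ (Fin m → Λ)) :=
      (IsProjective.iff_projective (R := Λ) (Fin m → Λ)).1 inferInstance
    refine hS.subsingleton_ext_one_X₃_left (fun f => ?_) (Ext.subsingleton_of_projective _ _ 0)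
    obtain ⟨Y, hY, g, h, hgh⟩ := hX _ f.hom
    obtain ⟨g', hg'⟩ := hS.exists_extension (hA Y hY) (ModuleCat.ofHom g)
    refine ⟨g' ≫ ModuleCat.ofHom h, ?_⟩
    rw [reassoc_of% hg']
    exact ModuleCat.hom_ext hgh
  | succ i ih =>
    intro A _ hA
    obtain ⟨m, p, hp⟩ := Module.Finite.exists_fin' Λ A
    have hS := shortExact_ker p hp
    have hproj : Projective (ModuleCat.of Λ (Fin m → Λ)) :=
      (IsProjective.iff_projective (R := Λ) (Fin m → Λ)).1 inferInstance
    have hfin : Module.Finite Λ (ModuleCat.of Λ (LinearMap.ker p)) :=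
      inferInstanceAs (Module.Finite Λ (LinearMap.ker p))
    refine hS.subsingleton_ext_X₃_left (ih _ fun Y hY => ?_)
      (Ext.subsingleton_of_projective _ _ (i + 1))
    exact hS.subsingleton_ext_X₁_left (Ext.subsingleton_of_projective _ _ i) (hA Y hY)

/-- The right perpendicular class of `M` in the category of all modules consists of the modules
that locally factor through `M`. -/
theorem IsClusterTilting.rightPerp_iff_locallyFactors (hM : IsClusterTilting.{u} n M) (hn : 2 ≤ n)
    (X : ModuleCat.{u} Λ) : rightPerp.{u} n (toMod M) X ↔ LocallyFactors (toMod M) X := by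
  refine ⟨hM.locallyFactors_of_rightPerp hn, fun hX A hA i hi hin => ?_⟩
  have := toMod_finite hA
  obtain ⟨i, rfl⟩ := Nat.exists_eq_succ_of_ne_zero hi.ne'
  exact subsingleton_ext_of_locallyFactors hX i A fun Y hY => hM.subsingleton_ext hA hY hi hin

theorem IsClusterTilting.isApproximating (hM : IsClusterTilting.{u} n M) (hn : 2 ≤ n) :
    IsApproximating (toMod M) where
  finite _ hY := toMod_finite hY
  of_locallyFactors Y _ hY := hM.toMod_of_rightPerp ((hM.rightPerp_iff_locallyFactors hn Y).2 hY)
  exists_approximation A _ _ _ := by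
    obtain ⟨Y, θ, hY, -, hθ⟩ := hM.exists_approximation A
    exact ⟨Y, θ, hY, hθ⟩

end ToMod

end ClusterTilting

namespace ClusterTilting

/-! ### Approximations and perpendicular classes of Add(P). -/

section AddClosure

variable {Λ : Type u} [Ring Λ] {P : ObjectProperty (ModuleCat.{u} Λ)}

open Abelian

theorem addClosure_directSum {ι : Type u} (Y : ι → ModuleCat.{u} Λ) (hY : ∀ k, P (Y k)) :
    AddClosure P (ModuleCat.of Λ (DirectSum ι fun k => Y k)) :=
  ⟨ι, Y, hY, ⟨Retract.refl _⟩⟩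

theorem AddClosure.of_retract {X Y : ModuleCat.{u} Λ} (hY : AddClosure P Y) (ρ : Retract X Y) :
    AddClosure P X := by
  obtain ⟨ι, Z, hZ, ⟨ρ'⟩⟩ := hY
  exact ⟨ι, Z, hZ, ⟨ρ.trans ρ'⟩⟩

theorem le_addClosure : P ≤ AddClosure P := by
  classical
  intro X hX
  refine (addClosure_directSum (fun _ : PUnit.{u + 1} => X) fun _ => hX).of_retract
    ⟨ModuleCat.ofHom (DirectSum.lof Λ PUnit.{u + 1} (fun _ => X) PUnit.unit),
      ModuleCat.ofHom (DirectSum.component Λ PUnit.{u + 1} (fun _ => X) PUnit.unit), ?_⟩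
  ext x
  exact DirectSum.component.lof_self (M := fun _ : PUnit.{u + 1} => (X : Type u)) Λ PUnit.unit x

/-- Embedding `X` in an injective turns degree one into lifting maps to the cokernel, which is done
summand by summand. Higher degrees shift to cosyzygies. -/
theorem subsingleton_ext_of_addClosure (i : ℕ) : ∀ {X : ModuleCat.{u} Λ},
    (∀ Y, P Y → Subsingleton (Ext.{u} Y X (i + 1))) → ∀ {A : ModuleCat.{u} Λ}, AddClosure P A →
      Subsingleton (Ext.{u} A X (i + 1)) := by
  classical
  induction i with
  | zero =>
    rintro X hX A ⟨ι, Y, hY, ⟨ρ⟩⟩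
    let I := Injective.under X
    have hS : (ShortComplex.mk (Injective.ι X) (cokernel.π (Injective.ι X))
      (cokernel.condition _)).ShortExact := { exact := ShortComplex.exact_cokernel _ }
    refine hS.subsingleton_ext_one_X₁_right (fun f => ?_) (Ext.subsingleton_of_injective _ _ 0)
    have h1 : ∀ k, ∃ g : Y k ⟶ I, g ≫ cokernel.π (Injective.ι X) =
        ModuleCat.ofHom (DirectSum.lof Λ ι (fun k => Y k) k) ≫ ρ.r ≫ f :=
      fun k => hS.exists_lift (hX _ (hY k)) _
    choose g hg using h1
    refine ⟨ρ.i ≫ ModuleCat.ofHom (DirectSum.toModule Λ ι I fun k => (g k).hom), ?_⟩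
    have h2 : ModuleCat.ofHom (DirectSum.toModule Λ ι I fun k => (g k).hom) ≫
        cokernel.π (Injective.ι X) = ρ.r ≫ f := by
      refine ModuleCat.hom_ext (DirectSum.linearMap_ext Λ fun k => ?_)
      refine Eq.trans ?_ (congrArg ModuleCat.Hom.hom (hg k))
      ext y
      simp
    have h3 : ρ.i ≫ ModuleCat.ofHom (DirectSum.toModule Λ ι I fun k => (g k).hom) ≫
        cokernel.π (Injective.ι X) = f := by rw [h2, ρ.retract_assoc]
    exact (Category.assoc _ _ _).trans h3
  | succ i ih =>
    intro X hX A hA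
    have hS : (ShortComplex.mk (Injective.ι X) (cokernel.π (Injective.ι X))
      (cokernel.condition _)).ShortExact := { exact := ShortComplex.exact_cokernel _ }
    refine hS.subsingleton_ext_X₁_right (ih (fun Y hY => ?_) hA)
      (Ext.subsingleton_of_injective _ _ (i + 1))
    exact hS.subsingleton_ext_X₃_right (Ext.subsingleton_of_injective _ _ i) (hX Y hY)

theorem rightPerp_addClosure (n : ℕ) :
    rightPerp.{u} n (AddClosure P) = rightPerp.{u} n P := by
  refine le_antisymm (fun X hX Y hY => hX Y (le_addClosure Y hY)) fun X hX Y hY i hi hin => ?_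
  obtain ⟨i, rfl⟩ := Nat.exists_eq_succ_of_ne_zero hi.ne'
  exact subsingleton_ext_of_addClosure i (fun Z hZ => hX Z hZ _ hi hin) hY

theorem rightPerp_of_injective (n : ℕ) (I : ModuleCat.{u} Λ) [Injective I] :
    rightPerp.{u} n P I := by
  intro X _ i hi _
  obtain ⟨i, rfl⟩ := Nat.exists_eq_succ_of_ne_zero hi.ne'
  exact Ext.subsingleton_of_injective _ _ i

theorem IsApproximating.exists_fgModel [IsNoetherianRing Λ] (hP : IsApproximating P)
    {Y : ModuleCat.{u} Λ} (hY : P Y) : ∃ x, P (fgModel x) ∧ Nonempty (Y ≃ₗ[Λ] fgModel x) := by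
  have := hP.finite Y hY
  obtain ⟨x, ⟨e⟩⟩ := ClusterTilting.exists_fgModel (Λ := Λ) Y
  exact ⟨x, hP.of_retract hY (fgModel x) e.symm.toLinearMap e.toLinearMap
      (LinearMap.ext fun y => e.apply_symm_apply y), ⟨e⟩⟩

theorem IsApproximating.exists_isRightApproximation [IsNoetherianRing Λ] (hP : IsApproximating P)
    (A : ModuleCat.{u} Λ) : ∃ (X : ModuleCat.{u} Λ) (θ : X ⟶ A),
      IsRightApproximation (AddClosure P) θ := by
  classical
  let K := Σ x : {x : Σ m : ℕ, Submodule Λ (Fin m → Λ) // P (fgModel x)}, (fgModel x.1 →ₗ[Λ] A)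
  let W : K → ModuleCat.{u} Λ := fun k => fgModel k.1.1
  let D := DirectSum K fun k => W k
  let θ : D →ₗ[Λ] A := DirectSum.toModule Λ K A fun k => k.2
  refine ⟨ModuleCat.of Λ D, ModuleCat.ofHom θ, addClosure_directSum W fun k => k.1.2, ?_⟩
  rintro Y f ⟨ι, Z, hZ, ⟨ρ⟩⟩
  have h1 : ∀ l, ∃ g : Z l →ₗ[Λ] D,
      θ ∘ₗ g = (ρ.r ≫ f).hom ∘ₗ DirectSum.lof Λ ι (fun l => Z l) l := by
    intro l
    obtain ⟨x, hx, ⟨e⟩⟩ := hP.exists_fgModel (hZ l)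
    let k : K := ⟨⟨x, hx⟩, ((ρ.r ≫ f).hom ∘ₗ DirectSum.lof Λ ι (fun l => Z l) l) ∘ₗ
      e.symm.toLinearMap⟩
    refine ⟨DirectSum.lof Λ K (fun k => W k) k ∘ₗ e.toLinearMap, LinearMap.ext fun z => ?_⟩
    refine (DirectSum.toModule_lof (M := fun k => (W k : Type u)) Λ k (e z)).trans ?_
    exact congrArg ((ρ.r ≫ f).hom ∘ₗ DirectSum.lof Λ ι (fun l => Z l) l) (e.symm_apply_apply z)
  choose g hg using h1
  let G : (DirectSum ι fun l => Z l) →ₗ[Λ] D := DirectSum.toModule Λ ι D g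
  have hG : θ ∘ₗ G = (ρ.r ≫ f).hom := by
    refine DirectSum.linearMap_ext Λ fun l => ?_
    rw [← hg l]
    ext z
    exact congrArg θ (DirectSum.toModule_lof (M := fun l => (Z l : Type u)) Λ l z)
  refine ⟨ρ.i ≫ ModuleCat.ofHom G, ?_⟩
  have h2 : ModuleCat.ofHom G ≫ ModuleCat.ofHom θ = ρ.r ≫ f := ModuleCat.hom_ext hG
  rw [Category.assoc, h2, ρ.retract_assoc]

/-- If all modules locally factoring through `P` lie in `Add P`, then the embedding of a direct
sum of modules in `P` into their product splits. -/
theorem IsApproximating.exists_retraction_sumToPi [IsNoetherianRing Λ] (hP : IsApproximating P)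
    (hc : ∀ X : ModuleCat.{u} Λ, LocallyFactors P X → AddClosure P X)
    {ι : Type u} (Y : ι → ModuleCat.{u} Λ) (hY : ∀ k, P (Y k)) :
    ∃ ρ : (∀ k, Y k) →ₗ[Λ] DirectSum ι fun k => Y k,
      ρ ∘ₗ sumToPi (fun k => Y k) = LinearMap.id := by
  classical
  let φ : (DirectSum ι fun k => Y k) →ₗ[Λ] (∀ k, Y k) := sumToPi _
  have hφ : IsPureMap φ := isPureMap_sumToPi
  have hpi : LocallyFactors P (∀ k, Y k) :=
    hP.locallyFactors_pi fun k => LocallyFactors.of_prop (hY k)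
  obtain ⟨κ, Z, hZ, ⟨r⟩⟩ := hc (ModuleCat.of Λ ((∀ k, Y k) ⧸ LinearMap.range φ)) (hpi.quotient hφ)
  have : ∀ l, Module.Finite Λ (Z l) := fun l => hP.finite _ (hZ l)
  -- The quotient is a summand of a sum of finitely generated modules, and maps from these lift
  -- along the pure epimorphism, so the quotient map has a section.
  have hlift := fun l => hφ.exists_lift (r.r.hom ∘ₗ DirectSum.lof Λ κ (fun l => Z l) l)
  choose t ht using hlift
  let τ : (DirectSum κ fun l => Z l) →ₗ[Λ] (∀ k, Y k) := DirectSum.toModule Λ κ _ t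
  have hτ : (LinearMap.range φ).mkQ ∘ₗ τ = r.r.hom := by
    refine DirectSum.linearMap_ext Λ fun l => ?_
    rw [← ht l]
    ext z
    exact congrArg (LinearMap.range φ).mkQ (DirectSum.toModule_lof (M := fun l => (Z l : Type u)) Λ l z)
  let σ : ((∀ k, Y k) ⧸ LinearMap.range φ) →ₗ[Λ] (∀ k, Y k) := τ ∘ₗ r.i.hom
  have hσ : ∀ x, (LinearMap.range φ).mkQ (σ x) = x := by
    intro x
    have h1 := LinearMap.congr_fun hτ (r.i.hom x)
    refine h1.trans ?_
    exact LinearMap.congr_fun (congrArg ModuleCat.Hom.hom r.retract) x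
  let e := LinearEquiv.ofInjective φ hφ.injective
  let δ : (∀ k, Y k) →ₗ[Λ] LinearMap.range φ :=
    (LinearMap.id - σ ∘ₗ (LinearMap.range φ).mkQ).codRestrict _ fun x => by
      refine (Submodule.Quotient.mk_eq_zero _).1 ?_
      change (LinearMap.range φ).mkQ (x - σ ((LinearMap.range φ).mkQ x)) = 0
      rw [map_sub, hσ, sub_self]
  refine ⟨e.symm.toLinearMap ∘ₗ δ, LinearMap.ext fun d => ?_⟩
  change e.symm (δ (φ d)) = d
  rw [LinearEquiv.symm_apply_eq]
  refine Subtype.ext ?_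
  have h0 : (LinearMap.range φ).mkQ (φ d) = 0 := (Submodule.Quotient.mk_eq_zero _).2 ⟨d, rfl⟩
  change φ d - σ ((LinearMap.range φ).mkQ (φ d)) = φ d
  rw [h0, map_zero, sub_zero]

/-- The product over all maps from `A` to small models in `P` lies in Add(P) by hypothesis. A map to
a direct sum extends to it coordinatewise, as a map to the product, and the retraction ∏ → ⊕ brings
it back. -/
theorem IsApproximating.exists_isLeftApproximation [IsNoetherianRing Λ] (hP : IsApproximating P)
    (hc : ∀ X : ModuleCat.{u} Λ, LocallyFactors P X → AddClosure P X)
    (A : ModuleCat.{u} Λ) : ∃ (X : ModuleCat.{u} Λ) (θ : A ⟶ X),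
      IsLeftApproximation (AddClosure P) θ := by
  let K := Σ x : {x : Σ m : ℕ, Submodule Λ (Fin m → Λ) // P (fgModel x)}, (A →ₗ[Λ] fgModel x.1)
  let W : K → ModuleCat.{u} Λ := fun k => fgModel k.1.1
  let θ : A →ₗ[Λ] (∀ k, W k) := LinearMap.pi fun k => k.2
  refine ⟨ModuleCat.of Λ (∀ k, W k), ModuleCat.ofHom θ, hc _ (hP.locallyFactors_pi fun k =>
    LocallyFactors.of_prop k.1.2), ?_⟩
  rintro Y f ⟨ι, Z, hZ, ⟨ρ⟩⟩
  obtain ⟨τ, hτ⟩ := hP.exists_retraction_sumToPi hc Z hZ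
  have h1 : ∀ l, ∃ g : (∀ k, W k) →ₗ[Λ] Z l,
      g ∘ₗ θ = LinearMap.proj l ∘ₗ sumToPi (fun l => Z l) ∘ₗ (f ≫ ρ.i).hom := by
    intro l
    obtain ⟨x, hx, ⟨e⟩⟩ := hP.exists_fgModel (hZ l)
    let k : K := ⟨⟨x, hx⟩, e.toLinearMap ∘ₗ
      LinearMap.proj l ∘ₗ sumToPi (fun l => Z l) ∘ₗ (f ≫ ρ.i).hom⟩
    exact ⟨e.symm.toLinearMap ∘ₗ LinearMap.proj k, LinearMap.ext fun z => e.symm_apply_apply _⟩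
  choose g hg using h1
  have hG : LinearMap.pi g ∘ₗ θ = sumToPi (fun l => Z l) ∘ₗ (f ≫ ρ.i).hom :=
    LinearMap.ext fun z => funext fun l => LinearMap.congr_fun (hg l) z
  refine ⟨ModuleCat.ofHom (τ ∘ₗ LinearMap.pi g) ≫ ρ.r, ?_⟩
  have h2 : ModuleCat.ofHom θ ≫ ModuleCat.ofHom (τ ∘ₗ LinearMap.pi g) = f ≫ ρ.i := by
    refine ModuleCat.hom_ext ?_
    change (τ ∘ₗ LinearMap.pi g) ∘ₗ θ = _
    rw [LinearMap.comp_assoc, hG, ← LinearMap.comp_assoc, hτ, LinearMap.id_comp]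
  rw [reassoc_of% h2, ρ.retract, Category.comp_id]

/-- If `Q` has epic right approximations and equals its right perpendicular class, then every
object left perpendicular to `Q` is a direct summand of an object of `Q`. -/
theorem exists_retract_of_leftPerp {C : Type u} [Category.{v} C] [Abelian C] [HasExt.{w} C]
    {n : ℕ} (hn : 2 ≤ n) {Q : ObjectProperty C} (hQ : rightPerp.{w} n Q = Q)
    (happ : ∀ A : C, ∃ (X : C) (θ : X ⟶ A), IsRightApproximation Q θ ∧ Epi θ)
    {X : C} (hX : leftPerp.{w} n Q X) : ∃ Y, Q Y ∧ Nonempty (Retract X Y) := by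
  have hQQ : ∀ Z Y, Q Z → Q Y → ∀ i, 0 < i → i < n → Subsingleton (Ext.{w} Z Y i) := by
    intro Z Y hZ hY
    rw [← hQ] at hY
    exact hY Z hZ
  have hses : ∀ {A Y : C} (θ : Y ⟶ A) [Epi θ], (ShortComplex.mk (kernel.ι θ) θ
      (kernel.condition θ)).ShortExact := fun θ _ => { exact := ShortComplex.exact_kernel θ }
  -- Dually to `IsClusterTilting.locallyFactors_of_rightPerp`, kernels of epic right approximations
  -- gain degrees until the kernel lies in `Q`.
  have key : ∀ d k : ℕ, k + 1 + d + 1 = n → ∀ D : C,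
      (∀ Z, Q Z → ∀ i, 0 < i → i ≤ k + 1 → Subsingleton (Ext.{w} Z D i)) →
      Subsingleton (Ext.{w} X D (k + 1)) := by
    intro d
    induction d with
    | zero =>
      intro k hk D hD
      refine hX D ?_ _ (by lia) (by lia)
      rw [← hQ]
      exact fun Z hZ i hi hin => hD Z hZ i hi (by lia)
    | succ d ih =>
      intro k hk D hD
      obtain ⟨Y, θ, ⟨hY, hθ⟩, _⟩ := happ D
      refine (hses θ).subsingleton_ext_X₃_right (hX Y hY _ (by lia) (by lia)) ?_
      refine ih (k + 1) (by lia) _ fun Z hZ i hi hik => ?_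
      obtain ⟨i, rfl⟩ := Nat.exists_eq_succ_of_ne_zero hi.ne'
      rcases Nat.eq_zero_or_pos i with rfl | hi0
      · exact (hses θ).subsingleton_ext_one_X₁_right (fun f => hθ Z f hZ)
          (hQQ Z Y hZ hY _ (by lia) (by lia))
      · exact (hses θ).subsingleton_ext_X₁_right (hD Z hZ i hi0 (by lia))
          (hQQ Z Y hZ hY _ (by lia) (by lia))
  obtain ⟨Y, θ, ⟨hY, hθ⟩, _⟩ := happ X
  obtain ⟨s, hs⟩ := (hses θ).exists_lift (key (n - 2) 0 (by lia) _ fun Z hZ i hi hi1 => by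
    obtain rfl : i = 1 := by lia
    exact (hses θ).subsingleton_ext_one_X₁_right (fun f => hθ Z f hZ)
      (hQQ Z Y hZ hY _ (by lia) (by lia))) (𝟙 X)
  exact ⟨Y, hY, ⟨⟨s, θ, hs⟩⟩⟩

end AddClosure

/-! ### Powers as finite coproducts. -/

section FiniteCoproducts

variable {Λ : Type u} [Ring Λ]

/-- The finite coproducts of a finitely generated module are its powers. -/
theorem nonempty_pi_iso_coproduct (G : FGModuleCat.{u} Λ) (m : ℕ) :
    Nonempty (FGModuleCat.of Λ (Fin m → G) ≅ ∐ fun _ : Fin m => G) := by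
  let p : ∀ k : Fin m, FGModuleCat.of Λ (Fin m → G) ⟶ G := fun k =>
    FGModuleCat.ofHom (LinearMap.proj (R := Λ) (φ := fun _ : Fin m => (G : Type u)) k)
  let s : ∀ k : Fin m, G ⟶ FGModuleCat.of Λ (Fin m → G) := fun k =>
    FGModuleCat.ofHom (LinearMap.single Λ (fun _ : Fin m => (G : Type u)) k)
  have hsp : ∀ j k, s j ≫ p k = if j = k then 𝟙 G else 0 := by
    intro j k
    refine FGModuleCat.hom_ext (LinearMap.ext fun g => ?_)
    change (Pi.single j g : Fin m → G) k = _
    split_ifs with h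
    · subst h
      rw [Pi.single_eq_same]
      rfl
    · rw [Pi.single_eq_of_ne (Ne.symm h)]
      rfl
  have hps : ∑ k, p k ≫ s k = 𝟙 _ := by
    let H : (FGModuleCat.of Λ (Fin m → G) ⟶ FGModuleCat.of Λ (Fin m → G)) →+
        ((Fin m → G) →ₗ[Λ] (Fin m → G)) :=
      { toFun := fun t => t.hom.hom, map_zero' := rfl, map_add' := fun _ _ => rfl }
    refine FGModuleCat.hom_ext ((map_sum H _ _).trans (LinearMap.ext fun g => ?_))
    rw [LinearMap.sum_apply]
    exact LinearMap.sum_single_apply (fun _ : Fin m => (G : Type u)) g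
  refine ⟨⟨∑ k, p k ≫ Sigma.ι (fun _ : Fin m => G) k, Sigma.desc s, ?_, ?_⟩⟩
  · rw [Preadditive.sum_comp, ← hps]
    exact Finset.sum_congr rfl fun k _ => by simp
  · refine Sigma.hom_ext _ _ fun j => ?_
    rw [Sigma.ι_desc_assoc, Preadditive.comp_sum, Category.comp_id,
      Finset.sum_eq_single j]
    · rw [← Category.assoc, hsp, if_pos rfl, Category.id_comp]
    · intro k _ hk
      rw [← Category.assoc, hsp, if_neg (Ne.symm hk), zero_comp]
    · simp

theorem addGen_iff [IsNoetherianRing Λ] (G X : FGModuleCat.{u} Λ) :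
    addGen G X ↔ ∃ (m : ℕ) (s : X →ₗ[Λ] (Fin m → G)) (r : (Fin m → G) →ₗ[Λ] X),
      r ∘ₗ s = LinearMap.id := by
  constructor
  · rintro ⟨m, ⟨ρ⟩⟩
    obtain ⟨e⟩ := nonempty_pi_iso_coproduct G m
    refine ⟨m, (ρ.i ≫ e.inv).hom.hom, (e.hom ≫ ρ.r).hom.hom, ?_⟩
    have h1 : (ρ.i ≫ e.inv) ≫ e.hom ≫ ρ.r = 𝟙 X := by simp
    exact congrArg (fun t => t.hom.hom) h1
  · rintro ⟨m, s, r, h⟩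
    obtain ⟨e⟩ := nonempty_pi_iso_coproduct G m
    let s' : X ⟶ FGModuleCat.of Λ (Fin m → G) := FGModuleCat.ofHom s
    let r' : FGModuleCat.of Λ (Fin m → G) ⟶ X := FGModuleCat.ofHom r
    have h1 : s' ≫ r' = 𝟙 X := FGModuleCat.hom_ext h
    exact ⟨m, ⟨⟨s' ≫ e.hom, e.inv ≫ r', by simp [h1]⟩⟩⟩

end FiniteCoproducts

/-! ### Cluster tilting of Add(`M`) and finite type. -/

section Main

variable {Λ : Type u} [Ring Λ] [IsArtinAlgebra Λ] {n : ℕ} {M : ObjectProperty (FGModuleCat.{u} Λ)}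

open Abelian

theorem IsClusterTilting.toMod_self (hM : IsClusterTilting.{u} n M) :
    toMod M (ModuleCat.of Λ Λ) := by
  have : Module.Finite Λ (ModuleCat.of Λ Λ) := inferInstanceAs (Module.Finite Λ Λ)
  refine hM.toMod_of_leftPerp fun Y _ i hi _ => ?_
  have hproj : Projective (ModuleCat.of Λ Λ) :=
    (IsProjective.iff_projective (R := Λ) Λ).1 inferInstance
  obtain ⟨i, rfl⟩ := Nat.exists_eq_succ_of_ne_zero hi.ne'
  exact Ext.subsingleton_of_projective _ _ i

/-- If the right perpendicular class of `M` lies in `Add M`, then `Add M` is cluster tilting. -/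
theorem IsClusterTilting.addClosure (hM : IsClusterTilting.{u} n M) (hn : 2 ≤ n)
    (hc : rightPerp.{u} n (toMod M) ≤ AddClosure (toMod M)) :
    IsClusterTilting.{u} n (AddClosure (toMod M)) := by
  have hP := hM.isApproximating hn
  have hc' : ∀ X : ModuleCat.{u} Λ, LocallyFactors (toMod M) X → AddClosure (toMod M) X :=
    fun X hX => hc X ((hM.rightPerp_iff_locallyFactors hn X).2 hX)
  have hright : rightPerp.{u} n (AddClosure (toMod M)) = AddClosure (toMod M) := by
    rw [rightPerp_addClosure]
    exact le_antisymm hc fun X hX =>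
      (hM.rightPerp_iff_locallyFactors hn X).2 (hP.locallyFactors_of_addClosure hX)
  have happ : ∀ A : ModuleCat.{u} Λ, ∃ (X : ModuleCat.{u} Λ) (θ : X ⟶ A),
      IsRightApproximation (AddClosure (toMod M)) θ ∧ Epi θ := by
    intro A
    obtain ⟨X, θ, hθ⟩ := hP.exists_isRightApproximation A
    refine ⟨X, θ, hθ, (ModuleCat.epi_iff_surjective θ).2 fun a => ?_⟩
    -- `Λ` lies in `M`, so elements, viewed as maps from `Λ`, lift along right approximations.
    obtain ⟨g, hg⟩ := hθ.2 _ (ModuleCat.ofHom (LinearMap.toSpanSingleton Λ A a))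
      (le_addClosure _ hM.toMod_self)
    refine ⟨g.hom (1 : Λ), ?_⟩
    have h1 := LinearMap.congr_fun (congrArg ModuleCat.Hom.hom hg) (1 : Λ)
    refine h1.trans ?_
    simp
  refine ⟨fun A => ?_, fun A => ?_, fun A => ?_, hP.exists_isLeftApproximation hc', hright, ?_⟩
  · obtain ⟨X, θ, hθ, hepi⟩ := happ A
    exact ⟨X, θ, hθ.1, hepi⟩
  -- Injective modules are right perpendicular to everything, hence lie in Add(`M`) by `hc`.
  · exact ⟨Injective.under A, Injective.ι A, hc _ (rightPerp_of_injective n _), inferInstance⟩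
  · obtain ⟨X, θ, hθ, -⟩ := happ A
    exact ⟨X, θ, hθ⟩
  · refine le_antisymm (fun X hX => ?_) fun X hX Y hY => ?_
    · obtain ⟨Y, hY, ⟨ρ⟩⟩ := exists_retract_of_leftPerp hn hright happ hX
      exact AddClosure.of_retract hY ρ
    · rw [← hright] at hY
      exact hY X hX

theorem IsClusterTilting.of_toMod (hM : IsClusterTilting.{u} n M) {Z : FGModuleCat.{u} Λ}
    (hZ : toMod M Z.obj) : M Z := by
  rw [← hM.rightPerp_eq]
  exact fun X hX i hi hin =>
    (subsingleton_ext_fg_iff _ _ _).2 (hM.subsingleton_ext (toMod_obj hX) hZ hi hin)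

/-- `M` is of finite type if and only if it has an additive generator as a class of modules. -/
theorem IsClusterTilting.isOfFiniteType_iff (hM : IsClusterTilting.{u} n M) (hn : 2 ≤ n) :
    IsOfFiniteType M ↔ ∃ G : ModuleCat.{u} Λ, toMod M G ∧ ∀ Y, toMod M Y →
      ∃ (m : ℕ) (s : Y →ₗ[Λ] (Fin m → G)) (r : (Fin m → G) →ₗ[Λ] Y),
        r ∘ₗ s = LinearMap.id := by
  have hP := hM.isApproximating hn
  constructor
  · rintro ⟨G, rfl⟩
    refine ⟨G.obj, toMod_obj ((addGen_iff G G).2 ⟨1, LinearMap.pi fun _ => LinearMap.id,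
      LinearMap.proj 0, rfl⟩), ?_⟩
    rintro Y ⟨Z, hZ, ⟨e⟩⟩
    obtain ⟨m, s, r, h⟩ := (addGen_iff G Z).1 hZ
    refine ⟨m, s ∘ₗ e.inv.hom, e.hom.hom ∘ₗ r, ?_⟩
    rw [LinearMap.comp_assoc, ← LinearMap.comp_assoc e.inv.hom, h, LinearMap.id_comp,
      ← ModuleCat.hom_comp, e.inv_hom_id]
    rfl
  · rintro ⟨G, hG, hgen⟩
    have hfin := toMod_finite hG
    refine ⟨⟨G, hfin⟩, le_antisymm (fun X hX => (addGen_iff _ X).2 (hgen _ (toMod_obj hX)))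
      fun X hX => hM.of_toMod ?_⟩
    obtain ⟨m, s, r, h⟩ := (addGen_iff _ X).1 hX
    have hpi : LocallyFactors (toMod M) (ULift.{u} (Fin m) → G) :=
      hP.locallyFactors_pi fun _ => LocallyFactors.of_prop hG
    have : Module.Finite Λ X.obj := X.property
    refine hP.of_locallyFactors X.obj (hpi.of_retract
      (LinearMap.funLeft Λ G ULift.down ∘ₗ s) (r ∘ₗ LinearMap.funLeft Λ G ULift.up) ?_)
    rw [← h]
    rfl

end Main

end ClusterTilting

theorem theorem3p1 {Λ : Type u} [Ring Λ] [IsArtinAlgebra Λ] (n : ℕ) (hn : 2 ≤ n)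
    (M : ObjectProperty (FGModuleCat.{u} Λ)) (hM : ClusterTilting.IsClusterTilting.{u} n M) :
    List.TFAE [
      ClusterTilting.IsOfFiniteType M,
      ClusterTilting.rightPerp.{u} n (ClusterTilting.toMod M) =
        ClusterTilting.AddClosure (ClusterTilting.toMod M),
      ClusterTilting.rightPerp.{u} n (ClusterTilting.toMod M) ≤
        ClusterTilting.AddClosure (ClusterTilting.toMod M),
      ClusterTilting.IsClusterTilting.{u} n
        (ClusterTilting.AddClosure (ClusterTilting.toMod M))] := by
  have hP := hM.isApproximating hn
  tfae_have 1 → 3 := by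
    intro h X hX
    obtain ⟨G, hG, hgen⟩ := (hM.isOfFiniteType_iff hn).1 h
    exact hP.addClosure_of_generator hG hgen ((hM.rightPerp_iff_locallyFactors hn X).1 hX)
  tfae_have 3 → 1 := fun h => (hM.isOfFiniteType_iff hn).2 (hP.exists_generator fun X hX =>
    h X ((hM.rightPerp_iff_locallyFactors hn X).2 hX))
  tfae_have 3 → 4 := fun h => hM.addClosure hn h
  tfae_have 4 → 2 := fun h => by
    rw [← ClusterTilting.rightPerp_addClosure, h.rightPerp_eq]
  tfae_have 2 → 3 := fun h => h.le
  tfae_finish
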